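/- Let $K$ be a field, let $d,n\ge 0$ be integers and let $S=K[x_1,\dots,x_n]$ with its standard grading. Let $\Delta$ be a simplicial complex on the vertex set $[n]=\{1,\dots,n\}$ (a family of subsets of $[n]$ that is closed under taking subsets and contains $\varnothing$ and all singletons $\{i\}$), and let $I_\Delta\subseteq S$ be its Stanley–Reisner ideal, generated by the square-free monomials $\prod_{i\in F}x_i$ with $F\subseteq[n]$, $F\notin\Delta$. For a graded $S$-module $M$ write $\operatorname{indeg}(M)=\inf\{j: M_j\neq 0\}$, $\beta_{i,j}(M)=\dim_K\operatorname{Tor}^S_i(K,M)_j$ and $\operatorname{reg}(M)=\sup\{j-i:\beta_{i,j}(M)\neq 0\}$; $M$ has a $d$-linear resolution if $\operatorname{reg}(M)=d=\operatorname{indeg}(M)$. **Corollary.** Suppose that $\dim\Delta=d-1$ and $\operatorname{indeg}(I_\Delta)=d$. Then $I_\Delta$ has a $d$-linear resolution if and only if $\tilde H_{d-1}(\Delta;K)=0$, where $\tilde H_\ast(\Delta;K)$ denotes reduced simplicial homology with coefficients in $K$. -/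

import Mathlib

open scoped TensorProduct

universe u

noncomputable section

namespace LinRes

/-! ### Graded modules over a standard graded polynomial ring -/

/-- The polynomial ring `K[x_1, …, x_n]`, graded by total degree. -/
abbrev Poly (K : Type u) [Field K] (n : ℕ) : Type u := MvPolynomial (Fin n) K

/-- `ℳ` is a grading (in degrees `0, 1, 2, …`) of the module `M` over the standard graded
polynomial ring `S`: `M` is the internal direct sum of the `ℳ j`, and `S_k ℳ_j ⊆ ℳ_{k+j}`; the
`K`-module structure of `M` is the one induced by its `S`-module structure. -/
class IsGradedModule {K : Type u} [Field K] {n : ℕ} {M : Type u} [AddCommGroup M]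
    [Module (Poly K n) M] [Module K M] (ℳ : ℕ → Submodule K M) : Prop where
  C_smul : ∀ (c : K) (m : M), (MvPolynomial.C c : Poly K n) • m = c • m
  internal : DirectSum.IsInternal ℳ
  smul_mem : ∀ (k j : ℕ) (r : Poly K n) (m : M), r.IsHomogeneous k → m ∈ ℳ j → r • m ∈ ℳ (k + j)

/-- The degree `j` part of the graded free module `⨁_a S(-deg a)`: the coordinate at `a` is
homogeneous of degree `j - deg a`. -/
def freePart {K : Type u} [Field K] {n : ℕ} {ι : Type u} (deg : ι → ℕ) (j : ℕ) :
    Submodule K (ι →₀ Poly K n) where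
  carrier := {f | ∀ (a : ι) (m : Fin n →₀ ℕ), (f a).coeff m ≠ 0 → m.degree + deg a = j}
  zero_mem' := by intro a m h; simp at h
  add_mem' := by
    intro f g hf hg a m h
    by_contra hne
    have h1 : (f a).coeff m = 0 := by by_contra h'; exact hne (hf a m h')
    have h2 : (g a).coeff m = 0 := by by_contra h'; exact hne (hg a m h')
    simp [h1, h2] at h
  smul_mem' := by
    intro c f hf a m h
    refine hf a m fun h' => h ?_
    simp [h']

/-- A graded free resolution `⋯ → F_1 → F_0 → M → 0` with `F_i = ⨁_{a ∈ gen i} S(-deg i a)` and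
with differentials homogeneous of degree `0`. -/
structure GradedFreeResolution {K : Type u} [Field K] {n : ℕ} {M : Type u} [AddCommGroup M]
    [Module (Poly K n) M] [Module K M] (ℳ : ℕ → Submodule K M) where
  gen : ℕ → Type u
  deg : ∀ i, gen i → ℕ
  d : ∀ i, (gen (i + 1) →₀ Poly K n) →ₗ[Poly K n] (gen i →₀ Poly K n)
  aug : (gen 0 →₀ Poly K n) →ₗ[Poly K n] M
  d_deg : ∀ i a, d i (Finsupp.single a 1) ∈ freePart (K := K) (deg i) (deg (i + 1) a)
  aug_deg : ∀ a, aug (Finsupp.single a 1) ∈ ℳ (deg 0 a)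
  exact_succ : ∀ i, Function.Exact (d (i + 1)) (d i)
  exact_zero : Function.Exact (d 0) aug
  aug_surjective : Function.Surjective aug

/-! ### Graded Tor, Betti numbers, regularity -/

namespace GradedFreeResolution

variable {K : Type u} [Field K] {n : ℕ} {M : Type u} [AddCommGroup M]
  [Module (Poly K n) M] [Module K M] {ℳ : ℕ → Submodule K M}

/-- The term `K ⊗_S F_i`, where `K = S ⧸ (x_1, …, x_n)`. -/
def Tens (F : GradedFreeResolution (n := n) ℳ) (i : ℕ) : Type u :=
  (Poly K n ⧸ Ideal.span (Set.range (MvPolynomial.X : Fin n → Poly K n))) ⊗[Poly K n]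
    (F.gen i →₀ Poly K n)

instance (F : GradedFreeResolution (n := n) ℳ) (i : ℕ) : AddCommGroup (F.Tens i) :=
  inferInstanceAs (AddCommGroup ((Poly K n ⧸ Ideal.span (Set.range
    (MvPolynomial.X : Fin n → Poly K n))) ⊗[Poly K n] (F.gen i →₀ Poly K n)))

instance (F : GradedFreeResolution (n := n) ℳ) (i : ℕ) : Module K (F.Tens i) :=
  inferInstanceAs (Module K ((Poly K n ⧸ Ideal.span (Set.range
    (MvPolynomial.X : Fin n → Poly K n))) ⊗[Poly K n] (F.gen i →₀ Poly K n)))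

/-- The degree `j` part of `K ⊗_S F_i`; the module `K` is concentrated in degree `0`. -/
def tensPart (F : GradedFreeResolution (n := n) ℳ) (i j : ℕ) : Submodule K (F.Tens i) :=
  (freePart (K := K) (n := n) (F.deg i) j).map ((TensorProduct.mk (Poly K n)
    (Poly K n ⧸ Ideal.span (Set.range (MvPolynomial.X : Fin n → Poly K n)))
    (F.gen i →₀ Poly K n) 1).restrictScalars K)

/-- The differential `K ⊗_S F_{i+1} → K ⊗_S F_i`. -/
def tensD (F : GradedFreeResolution (n := n) ℳ) (i : ℕ) : F.Tens (i + 1) →ₗ[K] F.Tens i :=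
  ((F.d i).lTensor
    (Poly K n ⧸ Ideal.span (Set.range (MvPolynomial.X : Fin n → Poly K n)))).restrictScalars K

/-- Degree `j` cycles of `K ⊗_S F` in homological degree `i`. -/
def cycles (F : GradedFreeResolution (n := n) ℳ) : (i j : ℕ) → Submodule K (F.Tens i)
  | 0, j => F.tensPart 0 j
  | i + 1, j => F.tensPart (i + 1) j ⊓ LinearMap.ker (F.tensD i)

/-- Degree `j` boundaries of `K ⊗_S F` in homological degree `i`. -/
def boundaries (F : GradedFreeResolution (n := n) ℳ) (i j : ℕ) : Submodule K (F.Tens i) :=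
  (F.tensPart (i + 1) j).map (F.tensD i)

/-- `Tor_i^S(K, M)_j`, computed from the graded free resolution `F` of `M`: the degree `j` part of
the `i`-th homology of `K ⊗_S F`. -/
abbrev Tor (F : GradedFreeResolution (n := n) ℳ) (i j : ℕ) : Type u :=
  F.cycles i j ⧸ (F.boundaries i j).comap (F.cycles i j).subtype

end GradedFreeResolution

/-! ### Existence of graded free resolutions: the resolution by all homogeneous elements -/

section StandardResolution

variable {K : Type u} [Field K] {n : ℕ}

theorem single_mem_freePart {ι : Type u} (deg : ι → ℕ) (a : ι) (k : ℕ) (r : Poly K n)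
    (hr : r.IsHomogeneous k) :
    Finsupp.single a r ∈ freePart (K := K) (n := n) deg (k + deg a) := by
  classical
  intro b m h
  rw [Finsupp.single_apply] at h
  split_ifs at h with hab
  · subst hab
    have : m.degree = k := by
      by_contra hne
      exact h (hr.coeff_eq_zero hne)
    rw [this]
  · simp at h

theorem freePart_iSup {ι : Type u} (deg : ι → ℕ) :
    ⨆ j, freePart (K := K) (n := n) deg j = ⊤ := by
  rw [eq_top_iff]
  rintro f -
  induction f using Finsupp.induction_linear with
  | zero => exact Submodule.zero_mem _
  | add f g hf hg => exact Submodule.add_mem _ hf hg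
  | single a r =>
    rw [← MvPolynomial.sum_homogeneousComponent r, ← Finsupp.singleAddHom_apply, map_sum]
    refine Submodule.sum_mem _ fun k _ => ?_
    exact Submodule.mem_iSup_of_mem _ (single_mem_freePart deg a k _
      (MvPolynomial.homogeneousComponent_isHomogeneous k r))

instance freePart_isGraded {ι : Type u} (deg : ι → ℕ) :
    IsGradedModule (n := n) (freePart (K := K) (n := n) deg) where
  C_smul c f := by
    ext a m
    simp
  internal := by
    classical
    rw [DirectSum.isInternal_submodule_iff_iSupIndep_and_iSup_eq_top]
    refine ⟨?_, freePart_iSup deg⟩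
    rw [iSupIndep_iff_finsetSum_eq_zero_imp_eq_zero]
    intro s v hv h0 i hi
    ext a m
    by_contra hne
    have hm := hv i hi a m hne
    have h1 : ((∑ i ∈ s, v i) a).coeff m = 0 := by rw [h0]; simp
    rw [Finsupp.finsetSum_apply, MvPolynomial.coeff_sum, Finset.sum_eq_single i] at h1
    · exact hne h1
    · intro j hj hji
      by_contra h'
      exact hji ((hv j hj a m h').symm.trans hm)
    · exact fun h => absurd hi h
  smul_mem := by
    classical
    intro k j r f hr hf a m h
    rw [Finsupp.smul_apply, smul_eq_mul, MvPolynomial.coeff_mul] at h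
    obtain ⟨x, hx, hne⟩ := Finset.exists_ne_zero_of_sum_ne_zero h
    have h1 : x.1.degree = k := by
      by_contra h'
      exact hne (by rw [hr.coeff_eq_zero h', zero_mul])
    have h2 := hf a x.2 fun h' => hne (by rw [h', mul_zero])
    have h3 : x.1 + x.2 = m := by simpa using hx
    rw [← h3, map_add, h1, add_assoc, h2]

variable {P : Type u} [AddCommGroup P] [Module (Poly K n) P] [Module K P]

/-- The homogeneous elements of a submodule `N`, each together with a degree. -/
def HomGen (𝒢 : ℕ → Submodule K P) (N : Submodule (Poly K n) P) : Type u :=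
  Σ j : ℕ, {x : P // x ∈ N ∧ x ∈ 𝒢 j}

/-- The degree of a homogeneous element. -/
def homDeg (𝒢 : ℕ → Submodule K P) (N : Submodule (Poly K n) P) (a : HomGen 𝒢 N) : ℕ := a.1

/-- The map from the graded free module on the homogeneous elements of `N`. -/
def homMap (𝒢 : ℕ → Submodule K P) (N : Submodule (Poly K n) P) :
    (HomGen 𝒢 N →₀ Poly K n) →ₗ[Poly K n] P :=
  Finsupp.linearCombination (Poly K n) fun a => (a.2 : P)

/-- `N` is generated by its homogeneous elements. -/
def IsHomSub (𝒢 : ℕ → Submodule K P) (N : Submodule (Poly K n) P) : Prop :=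
  N ≤ Submodule.span (Poly K n) {x | x ∈ N ∧ ∃ j, x ∈ 𝒢 j}

theorem homMap_single (𝒢 : ℕ → Submodule K P) (N : Submodule (Poly K n) P) (a : HomGen 𝒢 N) :
    homMap 𝒢 N (Finsupp.single a 1) = (a.2 : P) := by
  simp [homMap]

theorem range_homMap {𝒢 : ℕ → Submodule K P} {N : Submodule (Poly K n) P} (h : IsHomSub 𝒢 N) :
    LinearMap.range (homMap 𝒢 N) = N := by
  rw [homMap, Finsupp.range_linearCombination]
  refine le_antisymm (Submodule.span_le.mpr ?_) (h.trans (Submodule.span_mono ?_))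
  · rintro _ ⟨a, rfl⟩
    exact a.2.2.1
  · rintro x ⟨hx, j, hj⟩
    exact ⟨⟨j, x, hx, hj⟩, rfl⟩

theorem isHomSub_top (𝒢 : ℕ → Submodule K P) [h : IsGradedModule (n := n) 𝒢] :
    IsHomSub 𝒢 (⊤ : Submodule (Poly K n) P) := by
  intro x _
  have hx : x ∈ ⨆ j, 𝒢 j := by rw [h.internal.submodule_iSup_eq_top]; trivial
  rw [Submodule.mem_iSup_iff_exists_finsupp] at hx
  obtain ⟨f, hf, rfl⟩ := hx
  exact Submodule.sum_mem _ fun j _ => Submodule.subset_span ⟨trivial, j, hf j⟩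

theorem homMap_mem (𝒢 : ℕ → Submodule K P) [h : IsGradedModule (n := n) 𝒢]
    (N : Submodule (Poly K n) P) (j : ℕ) (f : HomGen 𝒢 N →₀ Poly K n)
    (hf : f ∈ freePart (K := K) (homDeg 𝒢 N) j) : homMap 𝒢 N f ∈ 𝒢 j := by
  rw [homMap, Finsupp.linearCombination_apply]
  refine Submodule.sum_mem _ fun a _ => ?_
  by_cases hle : homDeg 𝒢 N a ≤ j
  · have hh : (f a).IsHomogeneous (j - homDeg 𝒢 N a) := by
      intro m hm
      have := hf a m hm
      have hw : Finsupp.weight (1 : Fin n → ℕ) m = m.degree := by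
        rw [Finsupp.degree_eq_weight_one]
        rfl
      omega
    have := h.smul_mem _ _ _ _ hh a.2.2.2
    rwa [show j - homDeg 𝒢 N a + a.1 = j from Nat.sub_add_cancel hle] at this
  · have h0 : f a = 0 := by
      ext m
      by_contra hne
      have := hf a m hne
      omega
    simp [h0]

theorem isHomSub_ker (𝒢 : ℕ → Submodule K P) [h : IsGradedModule (n := n) 𝒢]
    (N : Submodule (Poly K n) P) :
    IsHomSub (freePart (K := K) (homDeg 𝒢 N)) (LinearMap.ker (homMap 𝒢 N)) := by
  intro x hx
  have hx' : x ∈ ⨆ j, freePart (K := K) (n := n) (homDeg 𝒢 N) j := by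
    rw [freePart_iSup]; trivial
  rw [Submodule.mem_iSup_iff_exists_finsupp] at hx'
  obtain ⟨f, hf, rfl⟩ := hx'
  have h0 := (iSupIndep_iff_finsetSum_eq_zero_imp_eq_zero _).mp h.internal.submodule_iSupIndep
    f.support (fun j => homMap 𝒢 N (f j)) (fun j _ => homMap_mem 𝒢 N j _ (hf j))
    (by rw [LinearMap.mem_ker, Finsupp.sum, map_sum] at hx; exact hx)
  exact Submodule.sum_mem _ fun j hj => Submodule.subset_span ⟨h0 j hj, j, hf j⟩

/-- A graded free module together with a submodule of it. -/
structure Stage (K : Type u) [Field K] (n : ℕ) where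
  gen : Type u
  deg : gen → ℕ
  ker : Submodule (Poly K n) (gen →₀ Poly K n)

/-- Cover a module by the free module on its homogeneous elements; record the kernel. -/
def coverStage (𝒢 : ℕ → Submodule K P) (N : Submodule (Poly K n) P) : Stage K n where
  gen := HomGen 𝒢 N
  deg := homDeg 𝒢 N
  ker := LinearMap.ker (homMap 𝒢 N)

/-- The successive free modules and syzygy modules of the standard resolution. -/
def stage (ℳ : ℕ → Submodule K P) : ℕ → Stage K n
  | 0 => coverStage ℳ ⊤
  | i + 1 => coverStage (freePart (stage ℳ i).deg) (stage ℳ i).ker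

theorem isHomSub_stage (ℳ : ℕ → Submodule K P) [IsGradedModule (n := n) ℳ] (i : ℕ) :
    IsHomSub (freePart (K := K) (stage (n := n) ℳ i).deg) (stage (n := n) ℳ i).ker := by
  cases i with
  | zero => exact isHomSub_ker ℳ ⊤
  | succ i => exact isHomSub_ker (freePart (stage ℳ i).deg) (stage ℳ i).ker

/-- The standard graded free resolution of a graded module `M`: `F_0` is free on the homogeneous
elements of `M`, and `F_{i+1}` is free on the homogeneous elements of the `i`-th syzygy module. -/
def standardResolution (ℳ : ℕ → Submodule K P) [IsGradedModule (n := n) ℳ] :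
    GradedFreeResolution (n := n) ℳ where
  gen i := (stage (n := n) ℳ i).gen
  deg i := (stage (n := n) ℳ i).deg
  d i := homMap (freePart (stage (n := n) ℳ i).deg) (stage (n := n) ℳ i).ker
  aug := homMap ℳ ⊤
  d_deg i a := by
    refine (congrArg (· ∈ _) (homMap_single _ _ a)).mpr ?_
    exact a.2.2.2
  aug_deg a := by
    refine (congrArg (· ∈ _) (homMap_single _ _ a)).mpr ?_
    exact a.2.2.2
  exact_succ i y := SetLike.ext_iff.mp (range_homMap (isHomSub_stage ℳ (i + 1))).symm y
  exact_zero y := SetLike.ext_iff.mp (range_homMap (isHomSub_stage ℳ 0)).symm y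
  aug_surjective y := (SetLike.ext_iff.mp (range_homMap (isHomSub_top ℳ)) y).mpr trivial

end StandardResolution

/-- The graded Betti number `β_{i,j}(M) = dim_K Tor_i^S(K, M)_j`. -/
def betti {K : Type u} [Field K] {n : ℕ} {M : Type u} [AddCommGroup M] [Module (Poly K n) M]
    [Module K M] (ℳ : ℕ → Submodule K M) [IsGradedModule (n := n) ℳ] (i j : ℕ) : Cardinal.{u} :=
  Module.rank K ((standardResolution (n := n) ℳ).Tor i j)

/-- The Castelnuovo–Mumford regularity `sup {j - i | β_{i,j}(M) ≠ 0}`. -/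
def regularity {K : Type u} [Field K] {n : ℕ} {M : Type u} [AddCommGroup M] [Module (Poly K n) M]
    [Module K M] (ℳ : ℕ → Submodule K M) [IsGradedModule (n := n) ℳ] : EReal :=
  sSup {r : EReal | ∃ i j : ℕ, betti (n := n) ℳ i j ≠ 0 ∧ r = ((j : ℝ) - (i : ℝ) : ℝ)}

/-- The initial degree `inf {j | M_j ≠ 0}` (it is `⊤` for `M = 0`). -/
def indeg {K : Type u} [Field K] {M : Type u} [AddCommGroup M] [Module K M]
    (ℳ : ℕ → Submodule K M) : ℕ∞ :=
  sInf {x : ℕ∞ | ∃ j : ℕ, ℳ j ≠ ⊥ ∧ x = j}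

/-- `M` has a `d`-linear resolution: `reg M = d = indeg M`. -/
def HasLinearResolution {K : Type u} [Field K] {n : ℕ} {M : Type u} [AddCommGroup M]
    [Module (Poly K n) M] [Module K M] (ℳ : ℕ → Submodule K M) [IsGradedModule (n := n) ℳ]
    (d : ℕ) : Prop :=
  regularity (n := n) ℳ = ((d : ℝ) : EReal) ∧ indeg ℳ = (d : ℕ∞)

/-! ### Ideals as graded modules -/

/-- The degree `j` part of an ideal of the polynomial ring. -/
def idealPart {K : Type u} [Field K] {n : ℕ} (I : Ideal (Poly K n)) (j : ℕ) : Submodule K I :=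
  (MvPolynomial.homogeneousSubmodule (Fin n) K j).comap (I.subtype.restrictScalars K)

theorem idealPart_isGraded {K : Type u} [Field K] {n : ℕ} (I : Ideal (Poly K n))
    (hI : ∀ f ∈ I, ∀ j, MvPolynomial.homogeneousComponent j f ∈ I) :
    IsGradedModule (n := n) (idealPart I) where
  C_smul c f := by
    apply Subtype.ext
    simp [MvPolynomial.smul_eq_C_mul]
  internal := by
    classical
    rw [DirectSum.isInternal_submodule_iff_iSupIndep_and_iSup_eq_top]
    constructor
    · rw [iSupIndep_iff_finsetSum_eq_zero_imp_eq_zero]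
      intro s v hv h0 i hi
      have h1 : ∑ j ∈ s, (v j : Poly K n) = 0 := by
        have := congrArg I.subtype h0
        simpa using this
      have h2 := congrArg (MvPolynomial.homogeneousComponent i) h1
      rw [map_sum, map_zero, Finset.sum_eq_single i] at h2
      · have hv' : (v i : Poly K n) ∈ MvPolynomial.homogeneousSubmodule (Fin n) K i := hv i hi
        rw [MvPolynomial.homogeneousComponent_of_mem hv', if_pos rfl] at h2
        exact Subtype.ext h2
      · intro j hj hji
        have hv' : (v j : Poly K n) ∈ MvPolynomial.homogeneousSubmodule (Fin n) K j := hv j hj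
        rw [MvPolynomial.homogeneousComponent_of_mem hv', if_neg (Ne.symm hji)]
      · exact fun h => absurd hi h
    · rw [eq_top_iff]
      rintro x -
      have hx : x = ∑ j ∈ Finset.range ((x : Poly K n).totalDegree + 1),
          (⟨MvPolynomial.homogeneousComponent j (x : Poly K n), hI _ x.2 j⟩ : I) := by
        apply Subtype.ext
        rw [AddSubmonoidClass.coe_finsetSum]
        exact (MvPolynomial.sum_homogeneousComponent (x : Poly K n)).symm
      rw [hx]
      refine Submodule.sum_mem _ fun j _ => Submodule.mem_iSup_of_mem j ?_
      exact MvPolynomial.homogeneousComponent_isHomogeneous j _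
  smul_mem := by
    intro k j r m hr hm
    exact MvPolynomial.IsHomogeneous.mul hr hm

/-! ### Simplicial complexes -/

/-- `F` is a face of `Δ`. The empty set is a face of every simplicial complex. -/
def IsFace {n : ℕ} (Δ : AbstractSimplicialComplex (Fin n)) (F : Finset (Fin n)) : Prop :=
  F = ∅ ∨ F ∈ Δ.faces

open Classical in
/-- The dimension of `Δ`: the maximum of `|F| - 1` over the faces `F`. -/
def dimension {n : ℕ} (Δ : AbstractSimplicialComplex (Fin n)) : ℤ :=
  (((Finset.univ.filter fun F => IsFace Δ F).sup Finset.card : ℕ) : ℤ) - 1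

/-- The Stanley–Reisner ideal `I_Δ`, generated by the square-free monomials of the non-faces. -/
def stanleyReisnerIdeal (K : Type u) [Field K] {n : ℕ} (Δ : AbstractSimplicialComplex (Fin n)) :
    Ideal (Poly K n) :=
  Ideal.span {f | ∃ F : Finset (Fin n), ¬ IsFace Δ F ∧ f = ∏ i ∈ F, MvPolynomial.X i}

instance stanleyReisner_isGraded (K : Type u) [Field K] {n : ℕ}
    (Δ : AbstractSimplicialComplex (Fin n)) :
    IsGradedModule (n := n) (idealPart (stanleyReisnerIdeal K Δ)) := by
  apply idealPart_isGraded
  let _ := MvPolynomial.gradedAlgebra (σ := Fin n) (R := K)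
  have hh : (stanleyReisnerIdeal K Δ).IsHomogeneous
      (MvPolynomial.homogeneousSubmodule (Fin n) K) := by
    apply Ideal.homogeneous_span
    rintro _ ⟨F, -, rfl⟩
    exact ⟨∑ i ∈ F, 1, MvPolynomial.IsHomogeneous.prod F _ _
      fun i _ => MvPolynomial.isHomogeneous_X K i⟩
  intro f hf j
  exact (MvPolynomial.mem_iff_homogeneousComponent_mem hh f).mp hf j

/-- The boundary map on oriented simplices, on the `K`-vector space with basis all subsets of `[n]`:
for `F = [v_0 < ⋯ < v_k]`, `∂ F = ∑_j (-1)^j [v_0, …, v̂_j, …, v_k]`. -/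
def boundary (K : Type u) [Field K] (n : ℕ) :
    (Finset (Fin n) → K) →ₗ[K] (Finset (Fin n) → K) :=
  Fintype.linearCombination K fun F : Finset (Fin n) => ∑ v ∈ F,
    Pi.single (F.erase v) ((-1 : K) ^ (F.filter fun w => w < v).card)

/-- The chain space `C_i(Δ)` with basis the faces of dimension `i`, for `i ≥ -1`. -/
def chains (K : Type u) [Field K] {n : ℕ} (Δ : AbstractSimplicialComplex (Fin n)) (i : ℤ) :
    Submodule K (Finset (Fin n) → K) where
  carrier := {c | ∀ F, c F ≠ 0 → IsFace Δ F ∧ (F.card : ℤ) - 1 = i}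
  zero_mem' := fun F h => absurd rfl h
  add_mem' := by
    intro c c' hc hc' F h
    by_cases h1 : c F = 0
    · exact hc' F fun h2 => h (by simp [h1, h2])
    · exact hc F h1
  smul_mem' := by
    intro r c hc F h
    exact hc F fun h1 => h (by simp [h1])

/-- The cycles `Ker ∂_i` of the augmented oriented chain complex. -/
def simplicialCycles (K : Type u) [Field K] {n : ℕ} (Δ : AbstractSimplicialComplex (Fin n))
    (i : ℤ) : Submodule K (Finset (Fin n) → K) :=
  chains K Δ i ⊓ LinearMap.ker (boundary K n)

/-- The boundaries `Im ∂_{i+1}` of the augmented oriented chain complex. -/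
def simplicialBoundaries (K : Type u) [Field K] {n : ℕ} (Δ : AbstractSimplicialComplex (Fin n))
    (i : ℤ) : Submodule K (Finset (Fin n) → K) :=
  (chains K Δ (i + 1)).map (boundary K n)

/-- The reduced simplicial homology `H̃_i(Δ; K) = Ker ∂_i / Im ∂_{i+1}`. -/
abbrev ReducedHomology (K : Type u) [Field K] {n : ℕ} (Δ : AbstractSimplicialComplex (Fin n))
    (i : ℤ) : Type u :=
  simplicialCycles K Δ i ⧸ (simplicialBoundaries K Δ i).comap (simplicialCycles K Δ i).subtype

end LinRes
end

/-! The graded Betti numbers of `I_Δ` vanish exactly where the Koszul homology of `I_Δ` does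
(`tor_subsingleton_iff_koszulVanishes`): Koszul complexes of free modules are exact in positive
homological degree, so dimension shifting along any graded free resolution leads down to first
Koszul homology, which is read off a presentation. Since `indeg(I_Δ) = d`, the elements of degree
`d` are minimal generators, and linearity of the resolution means vanishing in all bidegrees `(i,
j)` with `j > i + d` (`hasLinearResolution_iff`).

The Koszul complex is multigraded, and in each multidegree `a` it is a complex of `K`-valued
functions on subsets with the simplicial boundary map. If some `a v ≥ 2`, coning with apex `v`
contracts it. Otherwise `a` is the indicator of a set `W`, and the chains live on those `F ⊆ W`
whose complement `W \ F` is a nonface. Suppose `|W| > i + d`. As faces have at most `d` vertices,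
all sets `F` of size `i` are allowed, and so are all those of size `i + 1` unless `|W| = i + 1 + d`.
Except in that critical case, a cone therefore bounds every cycle. In the critical case the cone has
to be changed by a boundary so that it vanishes at the complements of the `d`-element faces.

Complementation in `W`, with signs, turns the boundary into its transpose (`sum_starSign_mul`). Such
a change is therefore always possible if the boundary is injective on chains of `d`-element faces
(`exists_koszulD_add_eq`). There being no larger faces, this injectivity is precisely `H̃_{d-1}(Δ;
K) = 0`. Conversely, exactness in the single multidegree `W = [n]` already forces each
top-dimensional cycle to be zero, by pairing it with a suitable boundary
(`homology_of_multiVanishes`). -/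

noncomputable section

namespace LinRes

/-! ### The Koszul complex -/

section Koszul

variable {n : ℕ} {R : Type*} [CommRing R] {P Q : Type*} [AddCommGroup P] [Module R P]
  [AddCommGroup Q] [Module R Q]

/-- The sign with which `H` occurs in the boundary of `insert v H`. -/
def faceSign (R : Type*) [CommRing R] {n : ℕ} (H : Finset (Fin n)) (v : Fin n) : R :=
  (-1) ^ (H.filter fun w => w < v).card

theorem faceSign_mul_self (H : Finset (Fin n)) (v : Fin n) :
    faceSign R H v * faceSign R H v = 1 := by
  rw [faceSign, ← pow_add, ← two_mul, pow_mul]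
  simp

theorem faceSign_insert_of_lt {H : Finset (Fin n)} {u v : Fin n} (hu : u ∉ H) (huv : u < v) :
    faceSign R (insert u H) v = -faceSign R H v := by
  rw [faceSign, faceSign, Finset.filter_insert, if_pos huv, Finset.card_insert_of_notMem, pow_succ]
  · ring
  · simp [hu]

theorem faceSign_insert_of_not_lt {H : Finset (Fin n)} {u v : Fin n} (huv : ¬ u < v) :
    faceSign R (insert u H) v = faceSign R H v := by
  rw [faceSign, faceSign, Finset.filter_insert, if_neg huv]

theorem faceSign_erase (F : Finset (Fin n)) (v : Fin n) :
    faceSign R (F.erase v) v = faceSign R F v := by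
  rw [faceSign, faceSign]
  congr 2
  ext w
  simp only [Finset.mem_filter, Finset.mem_erase]
  constructor
  · rintro ⟨⟨-, h⟩, h'⟩; exact ⟨h, h'⟩
  · rintro ⟨h, h'⟩; exact ⟨⟨h'.ne, h⟩, h'⟩

/-- Inserting the smaller of the two vertices shifts the position of the larger one, but not the
other way round. This asymmetry is the sign behind `∂² = 0`. -/
theorem faceSign_mul_insert {H : Finset (Fin n)} {u v : Fin n} (hu : u ∉ H) (hv : v ∉ H)
    (huv : u ≠ v) : faceSign R H v * faceSign R (insert v H) u =
      -(faceSign R H u * faceSign R (insert u H) v) := by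
  rcases lt_or_gt_of_ne huv with h | h
  · rw [faceSign_insert_of_lt hu h, faceSign_insert_of_not_lt h.not_gt]
    ring
  · rw [faceSign_insert_of_lt hv h, faceSign_insert_of_not_lt h.not_gt]
    ring

/-- The Koszul differential of the sequence `x` with coefficients in `P`; a chain is a function
from the subsets of `[n]` to `P`. -/
def koszulD (x : Fin n → R) : (Finset (Fin n) → P) →ₗ[R] (Finset (Fin n) → P) where
  toFun c H := ∑ v ∈ Hᶜ, (faceSign R H v * x v) • c (insert v H)
  map_add' c c' := by
    ext H
    simp [Finset.sum_add_distrib]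
  map_smul' r c := by
    ext H
    simp only [Pi.smul_apply, RingHom.id_apply, Finset.smul_sum]
    exact Finset.sum_congr rfl fun v _ => smul_comm _ _ _

theorem koszulD_apply (x : Fin n → R) (c : Finset (Fin n) → P) (H : Finset (Fin n)) :
    koszulD x c H = ∑ v ∈ Hᶜ, (faceSign R H v * x v) • c (insert v H) := rfl

theorem koszulD_koszulD (x : Fin n → R) (c : Finset (Fin n) → P) :
    koszulD x (koszulD x c) = 0 := by
  ext H
  simp only [koszulD_apply, Finset.smul_sum, Pi.zero_apply]
  rw [Finset.sum_sigma']
  refine Finset.sum_involution (fun p _ => ⟨p.2, p.1⟩) ?_ ?_ ?_ ?_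
  · rintro ⟨v, u⟩ h
    simp only [Finset.mem_sigma, Finset.mem_compl, Finset.mem_insert, not_or] at h
    obtain ⟨hv, huv, hu⟩ := h
    dsimp only
    rw [Finset.insert_comm v u, smul_smul, smul_smul, ← add_smul]
    have := faceSign_mul_insert (R := R) hu hv huv
    have h0 : faceSign R H v * x v * (faceSign R (insert v H) u * x u) +
        faceSign R H u * x u * (faceSign R (insert u H) v * x v) = 0 := by
      linear_combination (x v * x u) * this
    rw [h0, zero_smul]
  · rintro ⟨v, u⟩ h _ he
    simp only [Finset.mem_sigma, Finset.mem_compl, Finset.mem_insert, not_or] at h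
    simp only [Sigma.mk.injEq] at he
    exact h.2.1 he.1
  · rintro ⟨v, u⟩ h
    simp only [Finset.mem_sigma, Finset.mem_compl, Finset.mem_insert, not_or] at h ⊢
    exact ⟨h.2.2, fun e => h.2.1 e.symm, h.1⟩
  · rintro ⟨v, u⟩ h
    rfl

theorem koszulD_map (x : Fin n → R) (φ : P →ₗ[R] Q) (c : Finset (Fin n) → P) :
    koszulD x (fun F => φ (c F)) = fun F => φ (koszulD x c F) := by
  ext H
  simp [koszulD_apply]

/-- The cone construction with apex `v`. -/
def cone (v : Fin n) (c : Finset (Fin n) → R) (F : Finset (Fin n)) : R :=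
  if v ∈ F then faceSign R F v * c (F.erase v) else 0

/-- Coning is a contracting homotopy of the full simplex. At a set containing `v`, the terms for `u
≠ v` in the two summands cancel; at a set avoiding `v`, only `u = v` contributes. Every explicit
primitive of a cycle below comes from this identity. -/
theorem koszulD_cone (v : Fin n) (c : Finset (Fin n) → R) :
    koszulD (fun _ => (1 : R)) (cone v c) + cone v (koszulD (fun _ => (1 : R)) c) = c := by
  ext H
  simp only [Pi.add_apply, koszulD_apply, cone, mul_one, smul_eq_mul]
  by_cases hv : v ∈ H
  · rw [if_pos hv]
    have hc : (H.erase v)ᶜ = insert v Hᶜ := by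
      ext w; by_cases h : w = v <;> simp [h]
    rw [hc, Finset.sum_insert (by simpa using hv), Finset.insert_erase hv, faceSign_erase, mul_add,
      ← mul_assoc, faceSign_mul_self, one_mul, Finset.mul_sum, add_left_comm,
      ← Finset.sum_add_distrib, Finset.sum_eq_zero, add_zero]
    intro u hu
    have hu : u ∉ H := by simpa using hu
    have huv : u ≠ v := fun h => hu (h ▸ hv)
    rw [if_pos (Finset.mem_insert_of_mem hv), Finset.erase_insert_of_ne huv]
    have h1 := faceSign_mul_insert (R := R) (H := H.erase v) (u := u) (v := v)
      (by simp [hu]) (by simp) huv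
    rw [Finset.insert_erase hv, faceSign_erase] at h1
    have h2 : faceSign R (insert u H) v = faceSign R (insert u (H.erase v)) v := by
      rw [← faceSign_erase (F := insert u H), ← faceSign_erase (F := insert u (H.erase v)),
        Finset.erase_insert_of_ne huv, Finset.erase_insert_of_ne huv, Finset.erase_idem]
    rw [h2]
    have h3 := faceSign_mul_self (R := R) (insert u (H.erase v)) v
    have h4 := faceSign_mul_self (R := R) H v
    have h5 : faceSign R H u * faceSign R (insert u (H.erase v)) v +
        faceSign R H v * faceSign R (H.erase v) u = 0 := by
      have h6 : faceSign R H u = -(faceSign R H v * faceSign R (H.erase v) u *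
          faceSign R (insert u (H.erase v)) v) := by
        linear_combination (faceSign R H v) * h1 - faceSign R H u * h4
      rw [h6]
      linear_combination -(faceSign R H v * faceSign R (H.erase v) u) * h3
    linear_combination c (insert u (H.erase v)) * h5
  · rw [if_neg hv, add_zero, Finset.sum_eq_single v]
    · rw [if_pos (Finset.mem_insert_self v H), Finset.erase_insert hv, ← mul_assoc,
        ← faceSign_erase (F := insert v H), Finset.erase_insert hv, faceSign_mul_self, one_mul]
    · intro u _ huv
      rw [if_neg, mul_zero]
      simp [hv, Ne.symm huv]
    · intro h
      simp [hv] at h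

/-- The Koszul chains of homological degree `i` and internal degree `j`. -/
def koszulChains (𝒢 : ℕ → AddSubgroup P) (i j : ℕ) : AddSubgroup (Finset (Fin n) → P) where
  carrier := {c | ∀ F, c F ≠ 0 → F.card = i ∧ ∃ k, k + i = j ∧ c F ∈ 𝒢 k}
  zero_mem' := fun F h => absurd rfl h
  add_mem' := by
    intro c c' hc hc' F h
    by_cases h1 : c F = 0
    · have h2 : (c + c') F = c' F := by simp [h1]
      rw [h2] at h ⊢
      exact hc' F h
    · obtain ⟨hi, k, hk, hm⟩ := hc F h1
      refine ⟨hi, k, hk, ?_⟩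
      by_cases h2 : c' F = 0
      · simpa [h2] using hm
      · obtain ⟨-, k', hk', hm'⟩ := hc' F h2
        obtain rfl : k = k' := by omega
        exact add_mem hm hm'
  neg_mem' := by
    intro c hc F h
    obtain ⟨hi, k, hk, hm⟩ := hc F (by simpa using h)
    exact ⟨hi, k, hk, neg_mem hm⟩

theorem koszulD_mem {x : Fin n → R} {𝒢 : ℕ → AddSubgroup P}
    (hx : ∀ k v, ∀ p ∈ 𝒢 k, x v • p ∈ 𝒢 (k + 1)) {i j : ℕ} {c : Finset (Fin n) → P}
    (hc : c ∈ koszulChains 𝒢 (i + 1) j) : koszulD x c ∈ koszulChains 𝒢 i j := by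
  intro H hH
  have key : ∀ v ∈ Hᶜ, c (insert v H) ≠ 0 → H.card = i ∧ ∃ k, k + i = j ∧
      (faceSign R H v * x v) • c (insert v H) ∈ 𝒢 k := by
    intro v hv hne
    obtain ⟨h1, k, hk, hm⟩ := hc _ hne
    rw [Finset.card_insert_of_notMem (by simpa using hv)] at h1
    refine ⟨by omega, k + 1, by omega, ?_⟩
    rw [mul_smul, faceSign]
    rcases neg_one_pow_eq_or R (H.filter fun w => w < v).card with h | h
    · rw [h, one_smul]; exact hx _ _ _ hm
    · rw [h, neg_one_smul]; exact neg_mem (hx _ _ _ hm)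
  obtain ⟨v, hv, hne⟩ := Finset.exists_ne_zero_of_sum_ne_zero hH
  obtain ⟨hi, k, hk, -⟩ := key v hv fun h => hne (by rw [h, smul_zero])
  refine ⟨hi, k, hk, sum_mem fun u hu => ?_⟩
  by_cases h0 : c (insert u H) = 0
  · rw [h0, smul_zero]; exact zero_mem _
  · obtain ⟨-, k', hk', hm⟩ := key u hu h0
    obtain rfl : k = k' := by omega
    exact hm

theorem map_mem_koszulChains {𝒜 : ℕ → AddSubgroup P} {ℬ : ℕ → AddSubgroup Q} (φ : P →ₗ[R] Q)
    (h : ∀ k, ∀ p ∈ 𝒜 k, φ p ∈ ℬ k) {i j : ℕ} {c : Finset (Fin n) → P}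
    (hc : c ∈ koszulChains 𝒜 i j) : (fun F => φ (c F)) ∈ koszulChains ℬ i j := by
  intro F hF
  obtain ⟨hi, k, hk, hm⟩ := hc F fun h0 => hF (by simp [h0])
  exact ⟨hi, k, hk, h _ _ hm⟩

theorem exists_lift_koszulChains {𝒜 : ℕ → AddSubgroup P} {ℬ : ℕ → AddSubgroup Q} (φ : P →ₗ[R] Q)
    (h : ∀ k, ∀ q ∈ ℬ k, ∃ p ∈ 𝒜 k, φ p = q) {i j : ℕ} {c : Finset (Fin n) → Q}
    (hc : c ∈ koszulChains ℬ i j) :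
    ∃ c' ∈ koszulChains 𝒜 i j, (fun F => φ (c' F)) = c := by
  have : ∀ F, ∃ p, φ p = c F ∧ (p ≠ 0 → F.card = i ∧ ∃ k, k + i = j ∧ p ∈ 𝒜 k) := by
    intro F
    by_cases h0 : c F = 0
    · exact ⟨0, by simp [h0], fun h => absurd rfl h⟩
    · obtain ⟨hi, k, hk, hm⟩ := hc F h0
      obtain ⟨p, hp, he⟩ := h k _ hm
      exact ⟨p, he, fun _ => ⟨hi, k, hk, hp⟩⟩
  choose c' h1 h2 using this
  exact ⟨c', h2, funext h1⟩

theorem koszulChains_inf_ker {𝒜 : ℕ → AddSubgroup P} (φ : P →ₗ[R] Q) {i j : ℕ}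
    {c : Finset (Fin n) → P} (hc : c ∈ koszulChains 𝒜 i j) (h0 : (fun F => φ (c F)) = 0) :
    c ∈ koszulChains (fun k => 𝒜 k ⊓ (LinearMap.ker φ).toAddSubgroup) i j := by
  intro F hF
  obtain ⟨hi, k, hk, hm⟩ := hc F hF
  exact ⟨hi, k, hk, hm, congrFun h0 F⟩

/-- The Koszul homology of `P` vanishes in homological degree `i` and internal degree `j`. -/
def KoszulVanishes (x : Fin n → R) (𝒢 : ℕ → AddSubgroup P) (i j : ℕ) : Prop :=
  ∀ c ∈ koszulChains 𝒢 i j, koszulD x c = 0 → ∃ b ∈ koszulChains 𝒢 (i + 1) j, koszulD x b = c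

/-- The connecting homomorphism of the Koszul homology of `0 → ker φ → P → Q → 0`. -/
theorem koszulVanishes_succ_iff {x : Fin n → R} {𝒜 : ℕ → AddSubgroup P} {ℬ : ℕ → AddSubgroup Q}
    (φ : P →ₗ[R] Q) (hx : ∀ k v, ∀ p ∈ 𝒜 k, x v • p ∈ 𝒜 (k + 1))
    (hφ : ∀ k, ∀ p ∈ 𝒜 k, φ p ∈ ℬ k) (hs : ∀ k, ∀ q ∈ ℬ k, ∃ p ∈ 𝒜 k, φ p = q) {i j : ℕ}
    (hP : KoszulVanishes x 𝒜 (i + 1) j) :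
    KoszulVanishes x ℬ (i + 1) j ↔
      ∀ b ∈ koszulChains 𝒜 (i + 1) j, (fun F => φ (koszulD x b F)) = 0 →
        ∃ e ∈ koszulChains (fun k => 𝒜 k ⊓ (LinearMap.ker φ).toAddSubgroup) (i + 1) j,
          koszulD x e = koszulD x b := by
  constructor
  · intro hQ b hb hc
    obtain ⟨e, he, hee⟩ := hQ _ (map_mem_koszulChains φ hφ hb) (by rw [koszulD_map, hc])
    obtain ⟨e', he', rfl⟩ := exists_lift_koszulChains φ hs he
    -- The cycle `φ ∘ b` bounds, so subtracting the boundary of a lifted primitive pushes `b` into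
    -- `ker φ` without changing its boundary.
    refine ⟨b - koszulD x e', koszulChains_inf_ker φ (sub_mem hb (koszulD_mem hx he')) ?_, ?_⟩
    · ext F
      have := congrFun hee F
      rw [koszulD_map] at this
      simp [this]
    · rw [map_sub, koszulD_koszulD, sub_zero]
  · intro h c hc hc0
    obtain ⟨c', hc', rfl⟩ := exists_lift_koszulChains φ hs hc
    rw [koszulD_map] at hc0
    obtain ⟨e, he, hee⟩ := h c' hc' hc0
    have he' : e ∈ koszulChains 𝒜 (i + 1) j := fun F hF => by
      obtain ⟨hi, k, hk, hm⟩ := he F hF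
      exact ⟨hi, k, hk, hm.1⟩
    obtain ⟨g, hg, hge⟩ := hP (c' - e) (sub_mem hc' he') (by rw [map_sub, hee, sub_self])
    refine ⟨_, map_mem_koszulChains φ hφ hg, ?_⟩
    rw [koszulD_map, hge]
    ext F
    have : φ (e F) = 0 := by
      by_cases h0 : e F = 0
      · rw [h0, map_zero]
      · obtain ⟨-, k, -, -, hm⟩ := he F h0
        exact hm
    simp [this]

/-- Dimension shifting for Koszul homology. -/
theorem koszulVanishes_shift {x : Fin n → R} {𝒜 : ℕ → AddSubgroup P} {ℬ : ℕ → AddSubgroup Q}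
    (φ : P →ₗ[R] Q) (hx : ∀ k v, ∀ p ∈ 𝒜 k, x v • p ∈ 𝒜 (k + 1))
    (hφ : ∀ k, ∀ p ∈ 𝒜 k, φ p ∈ ℬ k) (hs : ∀ k, ∀ q ∈ ℬ k, ∃ p ∈ 𝒜 k, φ p = q) {i j : ℕ}
    (hP : KoszulVanishes x 𝒜 (i + 1) j) (hP' : KoszulVanishes x 𝒜 i j) :
    KoszulVanishes x ℬ (i + 1) j ↔
      KoszulVanishes x (fun k => 𝒜 k ⊓ (LinearMap.ker φ).toAddSubgroup) i j := by
  rw [koszulVanishes_succ_iff φ hx hφ hs hP]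
  constructor
  · intro h c hc hc0
    have hc' : c ∈ koszulChains 𝒜 i j := fun F hF => by
      obtain ⟨hi, k, hk, hm⟩ := hc F hF
      exact ⟨hi, k, hk, hm.1⟩
    -- Vanishing for `P` in degree `i` makes every cycle of the kernel a value of the connecting
    -- map.
    obtain ⟨b, hb, rfl⟩ := hP' c hc' hc0
    refine h b hb ?_
    ext F
    by_cases h0 : koszulD x b F = 0
    · simp [h0]
    · obtain ⟨-, k, -, -, hm⟩ := hc F h0
      exact hm
  · intro h b hb hb0
    exact h _ (koszulChains_inf_ker φ (koszulD_mem hx hb) hb0) (koszulD_koszulD x b)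

end Koszul

/-- The boundary map of the full simplex as a Koszul differential. -/
theorem boundary_eq_koszulD (K : Type*) [Field K] (n : ℕ) (c : Finset (Fin n) → K) :
    boundary K n c = koszulD (fun _ => (1 : K)) c := by
  ext H
  rw [boundary, Fintype.linearCombination_apply, Finset.sum_apply, koszulD_apply]
  simp only [Pi.smul_apply, Finset.sum_apply, smul_eq_mul, Finset.mul_sum, mul_one]
  rw [Finset.sum_sigma']
  symm
  refine Finset.sum_bij_ne_zero (fun v _ _ => ⟨insert v H, v⟩) ?_ ?_ ?_ ?_
  · intro v hv _
    simp
  · intro v _ _ u _ _ h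
    simp only [Sigma.mk.injEq] at h
    exact eq_of_heq h.2
  · rintro ⟨F, v⟩ h hne
    simp only [Finset.mem_sigma, Finset.mem_univ, true_and] at h
    dsimp only at hne
    have hH : H = F.erase v := by
      by_contra h'
      exact hne (by rw [Pi.single_eq_of_ne h', mul_zero])
    subst hH
    refine ⟨v, by simp, ?_, by simp [Finset.insert_erase h]⟩
    rw [Pi.single_eq_same] at hne
    rwa [Finset.insert_erase h, faceSign_erase, mul_comm]
  · intro v hv _
    have hv : v ∉ H := by simpa using hv
    dsimp only
    rw [Finset.erase_insert hv, Pi.single_eq_same, mul_comm]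
    congr 1
    rw [← Finset.erase_insert hv, faceSign_erase, faceSign, Finset.erase_insert hv]

/-! ### The multigraded structure of Koszul complexes over the polynomial ring -/

section Multigraded

variable {n : ℕ} {K : Type*} [Field K]

/-- The exponent vector of the square-free monomial with support `F`. -/
def indicatorExp (F : Finset (Fin n)) : Fin n →₀ ℕ := ∑ v ∈ F, Finsupp.single v 1

theorem indicatorExp_apply (F : Finset (Fin n)) (v : Fin n) :
    indicatorExp F v = if v ∈ F then 1 else 0 := by
  simp [indicatorExp, Finsupp.finsetSum_apply, Finsupp.single_apply]

theorem degree_indicatorExp (F : Finset (Fin n)) : (indicatorExp F).degree = F.card := by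
  simp [indicatorExp, map_sum]

theorem indicatorExp_insert {H : Finset (Fin n)} {v : Fin n} (hv : v ∉ H) :
    indicatorExp (insert v H) = Finsupp.single v 1 + indicatorExp H :=
  Finset.sum_insert hv

theorem indicatorExp_le_iff {F : Finset (Fin n)} {a : Fin n →₀ ℕ} :
    indicatorExp F ≤ a ↔ ∀ v ∈ F, a v ≠ 0 := by
  constructor
  · intro h v hv
    have := h v
    rw [indicatorExp_apply, if_pos hv] at this
    omega
  · intro h v
    rw [indicatorExp_apply]
    split_ifs with hv
    · exact Nat.one_le_iff_ne_zero.mpr (h v hv)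
    · exact Nat.zero_le _

/-- The part of multidegree `a` of a Koszul chain, where `x^m e_F` has multidegree
`m + indicatorExp F`. -/
def multiPart (c : Finset (Fin n) → MvPolynomial (Fin n) K) (a : Fin n →₀ ℕ)
    (F : Finset (Fin n)) : K :=
  if indicatorExp F ≤ a then (c F).coeff (a - indicatorExp F) else 0

theorem multiPart_add_indicatorExp (c : Finset (Fin n) → MvPolynomial (Fin n) K) (m : Fin n →₀ ℕ)
    (F : Finset (Fin n)) : multiPart c (m + indicatorExp F) F = (c F).coeff m := by
  rw [multiPart, if_pos le_add_self, add_tsub_cancel_right]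

/-- The differential trades the vertex `v` for the variable `x_v`, which preserves multidegree and
leaves only the sign as coefficient. -/
theorem multiPart_koszulD (c : Finset (Fin n) → MvPolynomial (Fin n) K) (a : Fin n →₀ ℕ) :
    multiPart (koszulD (MvPolynomial.X (R := K)) c) a =
      koszulD (fun _ => (1 : K)) (multiPart c a) := by
  ext H
  rw [koszulD_apply, multiPart]
  split_ifs with hH
  · rw [koszulD_apply, MvPolynomial.coeff_sum]
    refine Finset.sum_congr rfl fun v hv => ?_
    have hv : v ∉ H := by simpa using hv
    have hs : (faceSign (MvPolynomial (Fin n) K) H v) = MvPolynomial.C (faceSign K H v) := by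
      simp [faceSign]
    rw [hs, smul_eq_mul, mul_assoc, MvPolynomial.coeff_C_mul, MvPolynomial.coeff_X_mul', mul_one,
      smul_eq_mul, multiPart]
    congr 1
    have h1 : v ∈ (a - indicatorExp H).support ↔ indicatorExp (insert v H) ≤ a := by
      rw [indicatorExp_le_iff] at hH ⊢
      rw [Finsupp.mem_support_iff, Finsupp.tsub_apply, indicatorExp_apply, if_neg hv,
        Finset.forall_mem_insert]
      simpa using fun _ => hH
    simp only [h1]
    rw [indicatorExp_insert hv, add_comm, tsub_add_eq_tsub_tsub]
  · symm
    refine Finset.sum_eq_zero fun v hv => ?_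
    rw [multiPart, if_neg, smul_zero]
    rw [indicatorExp_le_iff] at hH ⊢
    exact fun h => hH fun w hw => h w (Finset.mem_insert_of_mem hw)

/-- A polynomial chain has only finitely many nonzero multigraded parts, so primitives found in each
multidegree can be glued. The predicate `p` carries side conditions, such as degree or membership in
an ideal, through the gluing. -/
theorem exists_koszulD_eq_of_multiPart (c : Finset (Fin n) → MvPolynomial (Fin n) K)
    (p : Finset (Fin n) → (Fin n →₀ ℕ) → Prop)
    (h : ∀ a, ∃ b : Finset (Fin n) → K, koszulD (fun _ => (1 : K)) b = multiPart c a ∧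
      ∀ F, b F ≠ 0 → indicatorExp F ≤ a ∧ p F a) :
    ∃ b : Finset (Fin n) → MvPolynomial (Fin n) K, koszulD (MvPolynomial.X (R := K)) b = c ∧
      ∀ F m, (b F).coeff m ≠ 0 → p F (m + indicatorExp F) := by
  classical
  choose b hb hp using h
  let T : Finset (Fin n →₀ ℕ) :=
    Finset.univ.biUnion fun F => (c F).support.image fun m => m + indicatorExp F
  have hT : ∀ a, a ∉ T → multiPart c a = 0 := by
    intro a ha
    ext F
    rw [multiPart]
    split_ifs with hF
    · by_contra hne
      refine ha (Finset.mem_biUnion.mpr ⟨F, Finset.mem_univ _, Finset.mem_image.mpr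
        ⟨a - indicatorExp F, MvPolynomial.mem_support_iff.mpr hne, tsub_add_cancel_of_le hF⟩⟩)
    · rfl
  let b' : Finset (Fin n) → MvPolynomial (Fin n) K := fun F => ∑ a ∈ T,
    if indicatorExp F ≤ a then MvPolynomial.monomial (a - indicatorExp F) (b a F) else 0
  have hcoeff : ∀ F m, (b' F).coeff m =
      if m + indicatorExp F ∈ T then b (m + indicatorExp F) F else 0 := by
    intro F m
    rw [MvPolynomial.coeff_sum]
    have : ∀ a ∈ T, (if indicatorExp F ≤ a then
        MvPolynomial.monomial (a - indicatorExp F) (b a F) else 0).coeff m =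
        if a = m + indicatorExp F then b a F else 0 := by
      intro a _
      by_cases hF : indicatorExp F ≤ a
      · rw [if_pos hF, MvPolynomial.coeff_monomial]
        simp only [tsub_eq_iff_eq_add_of_le hF]
      · rw [if_neg hF, if_neg, MvPolynomial.coeff_zero]
        rintro rfl
        exact hF le_add_self
    rw [Finset.sum_congr rfl this, Finset.sum_ite_eq']
  have hpart : ∀ a ∈ T, multiPart b' a = b a := by
    intro a ha
    ext F
    rw [multiPart]
    split_ifs with hF
    · rw [hcoeff, tsub_add_cancel_of_le hF, if_pos ha]
    · by_contra hne
      exact hF (hp a F (Ne.symm hne)).1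
  have hpart' : ∀ a, a ∉ T → multiPart b' a = 0 := by
    intro a ha
    ext F
    rw [multiPart]
    split_ifs with hF
    · rw [hcoeff, tsub_add_cancel_of_le hF, if_neg ha]; rfl
    · rfl
  refine ⟨b', ?_, ?_⟩
  · ext F m
    rw [← multiPart_add_indicatorExp, ← multiPart_add_indicatorExp c, multiPart_koszulD]
    by_cases ha : m + indicatorExp F ∈ T
    · rw [hpart _ ha, hb]
    · rw [hpart' _ ha, hT _ ha, map_zero]
  · intro F m hne
    rw [hcoeff] at hne
    split_ifs at hne with ha
    · exact (hp _ F hne).2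
    · exact absurd rfl hne

theorem cone_ne_zero {v : Fin n} {c : Finset (Fin n) → K} {F : Finset (Fin n)}
    (h : cone v c F ≠ 0) : v ∈ F ∧ c (F.erase v) ≠ 0 := by
  rw [cone] at h
  split_ifs at h with hv
  · exact ⟨hv, right_ne_zero_of_mul h⟩
  · exact absurd rfl h

theorem koszulD_cone_of_cycle (v : Fin n) {c : Finset (Fin n) → K}
    (hc : koszulD (fun _ => (1 : K)) c = 0) : koszulD (fun _ => (1 : K)) (cone v c) = c := by
  have h := koszulD_cone v c
  rw [hc] at h
  have h0 : cone v (0 : Finset (Fin n) → K) = 0 := by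
    ext F
    simp [cone]
  rwa [h0, add_zero] at h

theorem multiPart_ne_zero {c : Finset (Fin n) → MvPolynomial (Fin n) K} {a : Fin n →₀ ℕ}
    {F : Finset (Fin n)} (h : multiPart c a F ≠ 0) :
    indicatorExp F ≤ a ∧ (c F).coeff (a - indicatorExp F) ≠ 0 := by
  rw [multiPart] at h
  split_ifs at h with hF
  · exact ⟨hF, h⟩
  · exact absurd rfl h

theorem koszulD_multiPart_eq_zero {c : Finset (Fin n) → MvPolynomial (Fin n) K}
    (hc : koszulD (MvPolynomial.X (R := K)) c = 0) (a : Fin n →₀ ℕ) :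
    koszulD (fun _ => (1 : K)) (multiPart c a) = 0 := by
  rw [← multiPart_koszulD, hc]
  ext F
  simp [multiPart]

theorem degree_add_card {a : Fin n →₀ ℕ} {F : Finset (Fin n)} (h : indicatorExp F ≤ a) :
    (a - indicatorExp F).degree + F.card = a.degree := by
  rw [← degree_indicatorExp F, ← map_add, tsub_add_cancel_of_le h]

theorem exists_cone_multiPart {c : Finset (Fin n) → MvPolynomial (Fin n) K}
    (hc : koszulD (MvPolynomial.X (R := K)) c = 0) {a : Fin n →₀ ℕ} {v : Fin n} (hv : a v ≠ 0) :
    ∃ b : Finset (Fin n) → K, koszulD (fun _ => (1 : K)) b = multiPart c a ∧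
      ∀ F, b F ≠ 0 → indicatorExp F ≤ a ∧ v ∈ F ∧ multiPart c a (F.erase v) ≠ 0 := by
  refine ⟨cone v (multiPart c a), koszulD_cone_of_cycle v (koszulD_multiPart_eq_zero hc a), ?_⟩
  intro F hF
  obtain ⟨hvF, hne⟩ := cone_ne_zero hF
  refine ⟨?_, hvF, hne⟩
  have h1 := (multiPart_ne_zero hne).1
  rw [indicatorExp_le_iff] at h1 ⊢
  intro w hw
  by_cases h : w = v
  · rwa [h]
  · exact h1 w (Finset.mem_erase.mpr ⟨h, hw⟩)

/-- The Koszul complex of the polynomial ring is exact away from the constants. -/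
theorem exists_koszulD_eq {c : Finset (Fin n) → MvPolynomial (Fin n) K} {i j : ℕ}
    (hc : koszulD (MvPolynomial.X (R := K)) c = 0) (h0 : (c ∅).coeff 0 = 0)
    (hd : ∀ F m, (c F).coeff m ≠ 0 → F.card = i ∧ m.degree + i = j) :
    ∃ b : Finset (Fin n) → MvPolynomial (Fin n) K, koszulD (MvPolynomial.X (R := K)) b = c ∧
      ∀ F m, (b F).coeff m ≠ 0 → F.card = i + 1 ∧ m.degree + (i + 1) = j := by
  obtain ⟨b, hb, hp⟩ := exists_koszulD_eq_of_multiPart c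
    (fun F a => F.card = i + 1 ∧ a.degree = j) (by
    intro a
    by_cases ha : a = 0
    -- In multidegree zero only the constant term at `∅` could survive, and it vanishes by `h0`. Any
    -- other multidegree offers an apex for a cone.
    · refine ⟨0, ?_, fun F h => absurd rfl h⟩
      rw [map_zero]
      symm
      ext F
      by_contra hne
      obtain ⟨h1, h2⟩ := multiPart_ne_zero hne
      rw [ha, nonpos_iff_eq_zero] at h1
      have hF : F = ∅ := by
        rw [← Finset.card_eq_zero, ← degree_indicatorExp, h1, map_zero]
      rw [hF, ha, zero_tsub] at h2
      exact h2 h0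
    · obtain ⟨v, hv⟩ := Finsupp.ne_iff.mp ha
      obtain ⟨b, hb, hbF⟩ := exists_cone_multiPart hc hv
      refine ⟨b, hb, fun F hF => ?_⟩
      obtain ⟨h1, hvF, h2⟩ := hbF F hF
      obtain ⟨h3, h4⟩ := multiPart_ne_zero h2
      obtain ⟨h5, h6⟩ := hd _ _ h4
      refine ⟨h1, ?_, ?_⟩
      · rw [← Finset.card_erase_add_one hvF, h5]
      · rw [← degree_add_card h3, h5, h6])
  refine ⟨b, hb, fun F m hne => ?_⟩
  obtain ⟨h1, h2⟩ := hp F m hne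
  refine ⟨h1, ?_⟩
  rw [← h2, map_add, degree_indicatorExp, h1]

end Multigraded

/-! ### Koszul complexes of graded free modules -/

section Free


variable {n : ℕ} {K : Type u} [Field K] {ι : Type u}

/-- The grading of a graded free module by additive subgroups. -/
def freeGrading (K : Type u) [Field K] (n : ℕ) {ι : Type u} (deg : ι → ℕ) (k : ℕ) :
    AddSubgroup (ι →₀ Poly K n) := (freePart (K := K) (n := n) deg k).toAddSubgroup

/-- The elements of a free module with coordinates in the ideal generated by the variables. -/
def HasZeroConstants (f : ι →₀ Poly K n) : Prop := ∀ a, (f a).coeff 0 = 0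

theorem exists_koszulD_eq_free (deg : ι → ℕ) {i j : ℕ} {c : Finset (Fin n) → ι →₀ Poly K n}
    (hc : c ∈ koszulChains (freeGrading K n deg) i j)
    (hc0 : koszulD (MvPolynomial.X (R := K)) c = 0)
    (h0 : HasZeroConstants (c ∅)) :
    ∃ b ∈ koszulChains (freeGrading K n deg) (i + 1) j,
      koszulD (MvPolynomial.X (R := K)) b = c := by
  classical
  have hcoord : ∀ a : ι, ∃ b : Finset (Fin n) → Poly K n,
      koszulD (MvPolynomial.X (R := K)) b = (fun F => c F a) ∧
      (∀ F m, (b F).coeff m ≠ 0 → F.card = i + 1 ∧ m.degree + (i + 1) + deg a = j) ∧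
      ((∀ F, c F a = 0) → b = 0) := by
    intro a
    by_cases ha : ∀ F, c F a = 0
    · refine ⟨0, ?_, by simp, fun _ => rfl⟩
      ext1 F
      simp [ha]
    · obtain ⟨b, hb, hp⟩ := exists_koszulD_eq (c := fun F => c F a) (i := i) (j := j - deg a)
        ((koszulD_map (MvPolynomial.X (R := K)) (Finsupp.lapply a) c).trans (by rw [hc0]; rfl))
        (h0 a) (by
          intro F m hne
          obtain ⟨hi, k, hk, hm⟩ := hc F (by intro h; simp [h] at hne)
          have := hm a m hne
          exact ⟨hi, by omega⟩)
      -- A nonzero coordinate guarantees that the truncated subtraction `j - deg a` is a true one.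
      have hle : i + deg a ≤ j := by
        push Not at ha
        obtain ⟨F, hF⟩ := ha
        obtain ⟨m, hm⟩ := MvPolynomial.ne_zero_iff.mp hF
        obtain ⟨hi, k, hk, hm'⟩ := hc F (by intro h; simp [h] at hm)
        have := hm' a m hm
        omega
      refine ⟨b, hb, fun F m hne => ?_, fun h => absurd h ha⟩
      have := hp F m hne
      exact ⟨this.1, by omega⟩
  choose b hb hp hz using hcoord
  -- The index set may be infinite. The primitives were chosen to be zero at coordinates where `c`
  -- vanishes, so together they have finite support.
  let T : Finset ι := Finset.univ.biUnion fun F => (c F).support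
  have hT : ∀ a, a ∉ T → b a = 0 := by
    intro a ha
    refine hz a fun F => ?_
    by_contra hne
    exact ha (Finset.mem_biUnion.mpr ⟨F, Finset.mem_univ _, Finsupp.mem_support_iff.mpr hne⟩)
  let b' : Finset (Fin n) → ι →₀ Poly K n := fun F => Finsupp.onFinset T (fun a => b a F) (by
    intro a hne
    by_contra ha
    exact hne (by rw [hT a ha]; rfl))
  refine ⟨b', ?_, ?_⟩
  · intro F hF
    obtain ⟨a, ha⟩ := Finsupp.ne_iff.mp hF
    obtain ⟨m, hm⟩ := MvPolynomial.ne_zero_iff.mp ha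
    have := hp a F m hm
    refine ⟨this.1, j - (i + 1), by omega, fun a' m' hm' => ?_⟩
    have := (hp a' F m' hm').2
    omega
  · ext1 F
    ext1 a
    have h1 := congrFun
      (koszulD_map (MvPolynomial.X (R := K)) (Finsupp.lapply (R := Poly K n) a) b') F
    exact h1.symm.trans (congrFun (hb a) F)

theorem koszulVanishes_free (deg : ι → ℕ) (i j : ℕ) :
    KoszulVanishes (MvPolynomial.X : Fin n → Poly K n) (freeGrading K n deg) (i + 1) j := by
  intro c hc hc0
  refine exists_koszulD_eq_free deg hc hc0 fun a => ?_
  by_cases h : c ∅ = 0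
  · simp [h]
  · have := (hc ∅ h).1
    simp at this

theorem hasZeroConstants_koszulD (b : Finset (Fin n) → ι →₀ Poly K n) (F : Finset (Fin n)) :
    HasZeroConstants (koszulD (MvPolynomial.X (R := K)) b F) := by
  intro a
  rw [koszulD_apply, Finsupp.finsetSum_apply, MvPolynomial.coeff_sum]
  refine Finset.sum_eq_zero fun v _ => ?_
  rw [Finsupp.smul_apply, smul_eq_mul, mul_comm (faceSign _ _ _), mul_assoc,
    MvPolynomial.coeff_X_mul']
  simp

theorem freeGrading_X_smul (deg : ι → ℕ) (k : ℕ) (v : Fin n) (p : ι →₀ Poly K n)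
    (hp : p ∈ freeGrading K n deg k) :
    (MvPolynomial.X v : Poly K n) • p ∈ freeGrading K n deg (k + 1) := by
  have := (freePart_isGraded (K := K) (n := n) deg).smul_mem 1 k _ p
    (MvPolynomial.isHomogeneous_X K v) hp
  rwa [add_comm] at this

end Free

/-! ### Tor and Koszul homology -/

section Components

variable {K : Type u} [Field K] {n : ℕ} {ι : Type u} {M : Type u} [AddCommGroup M]
  [Module (Poly K n) M] [Module K M]

/-- The grading of a graded module by additive subgroups. -/
def addGrading (ℳ : ℕ → Submodule K M) (k : ℕ) : AddSubgroup M := (ℳ k).toAddSubgroup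

theorem map_mem_of_single_mem (ℳ : ℕ → Submodule K M) [h : IsGradedModule (n := n) ℳ]
    {deg : ι → ℕ} (φ : (ι →₀ Poly K n) →ₗ[Poly K n] M)
    (hφ : ∀ a, φ (Finsupp.single a 1) ∈ ℳ (deg a)) {j : ℕ} {f : ι →₀ Poly K n}
    (hf : f ∈ freeGrading K n deg j) : φ f ∈ ℳ j := by
  rw [← Finsupp.sum_single f, Finsupp.sum, map_sum]
  refine Submodule.sum_mem _ fun a _ => ?_
  rw [← mul_one (f a), ← smul_eq_mul, ← Finsupp.smul_single, map_smul]
  by_cases hle : deg a ≤ j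
  · have hh : (f a).IsHomogeneous (j - deg a) := by
      intro m hm
      have := hf a m hm
      have hw : Finsupp.weight (1 : Fin n → ℕ) m = m.degree := by
        rw [Finsupp.degree_eq_weight_one]
        rfl
      omega
    have := h.smul_mem _ _ _ _ hh (hφ a)
    rwa [Nat.sub_add_cancel hle] at this
  · have h0 : f a = 0 := by
      ext m
      by_contra hne
      have := hf a m hne
      omega
    rw [h0, zero_smul]
    exact zero_mem _

theorem exists_homogeneous_preimage (ℳ : ℕ → Submodule K M) [h : IsGradedModule (n := n) ℳ]
    {deg : ι → ℕ} (φ : (ι →₀ Poly K n) →ₗ[Poly K n] M)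
    (hφ : ∀ a, φ (Finsupp.single a 1) ∈ ℳ (deg a)) {j : ℕ} (g : ι →₀ Poly K n)
    (hg : φ g ∈ ℳ j) : ∃ f ∈ freeGrading K n deg j, φ f = φ g := by
  have hx' : g ∈ ⨆ j, freePart (K := K) (n := n) deg j := by
    rw [freePart_iSup]; trivial
  rw [Submodule.mem_iSup_iff_exists_finsupp] at hx'
  obtain ⟨f, hf, rfl⟩ := hx'
  refine ⟨f j, hf j, ?_⟩
  -- The images of the components of the preimage, with the target element subtracted in degree `j`,
  -- sum to zero; independence kills each of them. The index `j` is inserted because component `j`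
  -- may be zero.
  have h0 := (iSupIndep_iff_finsetSum_eq_zero_imp_eq_zero _).mp h.internal.submodule_iSupIndep
    (insert j f.support) (fun k => φ (f k) - if k = j then φ (f.sum fun _ x => x) else 0)
    (fun k _ => ?_) ?_ j (Finset.mem_insert_self _ _)
  · simpa [sub_eq_zero] using h0
  · refine sub_mem (map_mem_of_single_mem ℳ φ hφ (hf k)) ?_
    split_ifs with hk
    · rw [hk]; exact hg
    · exact zero_mem _
  · rw [Finset.sum_sub_distrib, Finset.sum_ite_eq', if_pos (Finset.mem_insert_self _ _),
      ← map_sum, sub_eq_zero]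
    congr 1
    symm
    refine Finsupp.sum_of_support_subset f (Finset.subset_insert _ _) _ fun _ _ => rfl

/-- This lets `K ⊗ F` be handled through representatives in `F`, two of them being identified when
their difference has zero constant terms. -/
theorem mem_smul_top_iff (f : ι →₀ Poly K n) :
    f ∈ (Ideal.span (Set.range (MvPolynomial.X : Fin n → Poly K n)) • ⊤ :
      Submodule (Poly K n) (ι →₀ Poly K n)) ↔ HasZeroConstants f := by
  constructor
  · intro h a
    refine Submodule.smul_induction_on (p := fun f : ι →₀ Poly K n => (f a).coeff 0 = 0) h ?_ ?_
    · intro r hr g _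
      rw [← Set.image_univ, MvPolynomial.mem_ideal_span_X_image] at hr
      have : r.coeff 0 = 0 := by
        by_contra hne
        obtain ⟨v, -, hv⟩ := hr 0 (MvPolynomial.mem_support_iff.mpr hne)
        exact hv rfl
      rw [Finsupp.smul_apply, smul_eq_mul, ← MvPolynomial.constantCoeff_eq, map_mul,
        MvPolynomial.constantCoeff_eq, this, zero_mul]
    · intro g g' hg hg'
      rw [Finsupp.add_apply, MvPolynomial.coeff_add, hg, hg', add_zero]
  · intro h
    rw [← Finsupp.sum_single f]
    refine Submodule.sum_mem _ fun a _ => ?_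
    rw [← mul_one (f a), ← smul_eq_mul, ← Finsupp.smul_single]
    refine Submodule.smul_mem_smul ?_ trivial
    rw [← Set.image_univ, MvPolynomial.mem_ideal_span_X_image]
    intro m hm
    by_contra hv
    push Not at hv
    have hm0 : m = 0 := Finsupp.ext fun v => hv v trivial
    rw [hm0, MvPolynomial.mem_support_iff] at hm
    exact hm (h a)

theorem one_tmul_eq_iff (f g : ι →₀ Poly K n) :
    ((1 : Poly K n ⧸ Ideal.span (Set.range (MvPolynomial.X : Fin n → Poly K n))) ⊗ₜ[Poly K n] f =
      1 ⊗ₜ[Poly K n] g) ↔ HasZeroConstants (f - g) := by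
  rw [← mem_smul_top_iff, ← Submodule.Quotient.eq,
    ← (TensorProduct.quotTensorEquivQuotSMul (ι →₀ Poly K n)
      (Ideal.span (Set.range (MvPolynomial.X : Fin n → Poly K n)))).injective.eq_iff]
  have : ∀ x : ι →₀ Poly K n, TensorProduct.quotTensorEquivQuotSMul (ι →₀ Poly K n)
      (Ideal.span (Set.range (MvPolynomial.X : Fin n → Poly K n))) (1 ⊗ₜ[Poly K n] x) =
      Submodule.Quotient.mk x := by
    intro x
    have := TensorProduct.quotTensorEquivQuotSMul_mk_tmul (M := ι →₀ Poly K n)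
      (Ideal.span (Set.range (MvPolynomial.X : Fin n → Poly K n))) 1 x
    rwa [one_smul] at this
  rw [this, this]

end Components

namespace GradedFreeResolution

variable {K : Type u} [Field K] {n : ℕ} {M : Type u} [AddCommGroup M]
  [Module (Poly K n) M] [Module K M] {ℳ : ℕ → Submodule K M}

/-- The image of `f` in `K ⊗_S F_i`. -/
def tensMk (F : GradedFreeResolution (n := n) ℳ) (i : ℕ) (f : F.gen i →₀ Poly K n) : F.Tens i :=
  (1 : Poly K n ⧸ Ideal.span (Set.range (MvPolynomial.X : Fin n → Poly K n))) ⊗ₜ[Poly K n] f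

theorem tensMk_eq_iff (F : GradedFreeResolution (n := n) ℳ) {i : ℕ} {f g : F.gen i →₀ Poly K n} :
    F.tensMk i f = F.tensMk i g ↔ HasZeroConstants (f - g) := one_tmul_eq_iff f g

theorem tensD_tensMk (F : GradedFreeResolution (n := n) ℳ) (i : ℕ)
    (f : F.gen (i + 1) →₀ Poly K n) : F.tensD i (F.tensMk (i + 1) f) = F.tensMk i (F.d i f) := rfl

theorem tor_subsingleton_iff (F : GradedFreeResolution (n := n) ℳ) (i j : ℕ) :
    Subsingleton (F.Tor i j) ↔ F.cycles i j ≤ F.boundaries i j := by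
  rw [Submodule.Quotient.subsingleton_iff, Submodule.comap_subtype_eq_top]

theorem tensMk_mem_boundaries_iff (F : GradedFreeResolution (n := n) ℳ) {i j : ℕ}
    {f : F.gen i →₀ Poly K n} : F.tensMk i f ∈ F.boundaries i j ↔
      ∃ g ∈ freeGrading K n (F.deg (i + 1)) j, HasZeroConstants (f - F.d i g) := by
  simp only [← tensMk_eq_iff, ← tensD_tensMk]
  constructor
  · rintro ⟨_, ⟨g, hg, rfl⟩, h⟩
    exact ⟨g, hg, h.symm⟩
  · rintro ⟨g, hg, h⟩
    exact ⟨_, ⟨g, hg, rfl⟩, h.symm⟩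

theorem tor_zero_subsingleton_iff (F : GradedFreeResolution (n := n) ℳ) (j : ℕ) :
    Subsingleton (F.Tor 0 j) ↔ ∀ f ∈ freeGrading K n (F.deg 0) j,
      ∃ g ∈ freeGrading K n (F.deg 1) j, HasZeroConstants (f - F.d 0 g) := by
  rw [tor_subsingleton_iff]
  constructor
  · exact fun h f hf => F.tensMk_mem_boundaries_iff.mp (h ⟨f, hf, rfl⟩)
  · rintro h _ ⟨f, hf, rfl⟩
    exact F.tensMk_mem_boundaries_iff.mpr (h f hf)

theorem tor_succ_subsingleton_iff (F : GradedFreeResolution (n := n) ℳ) (i j : ℕ) :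
    Subsingleton (F.Tor (i + 1) j) ↔ ∀ f ∈ freeGrading K n (F.deg (i + 1)) j,
      HasZeroConstants (F.d i f) →
        ∃ g ∈ freeGrading K n (F.deg (i + 2)) j, HasZeroConstants (f - F.d (i + 1) g) := by
  rw [tor_subsingleton_iff]
  have key : ∀ f, F.tensD i (F.tensMk (i + 1) f) = 0 ↔ HasZeroConstants (F.d i f) := by
    intro f
    have h0 : (0 : F.Tens i) = F.tensMk i 0 := (TensorProduct.tmul_zero _ _).symm
    rw [tensD_tensMk, h0, tensMk_eq_iff, sub_zero]
  constructor
  · exact fun h f hf h0 => F.tensMk_mem_boundaries_iff.mp (h ⟨⟨f, hf, rfl⟩, (key f).mpr h0⟩)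
  · rintro h _ ⟨⟨f, hf, rfl⟩, h0⟩
    exact F.tensMk_mem_boundaries_iff.mpr (h f hf ((key f).mp h0))

theorem d_mem (F : GradedFreeResolution (n := n) ℳ) (i k : ℕ) (f : F.gen (i + 1) →₀ Poly K n)
    (hf : f ∈ freeGrading K n (F.deg (i + 1)) k) : F.d i f ∈ freeGrading K n (F.deg i) k :=
  map_mem_of_single_mem (freePart (F.deg i)) (F.d i) (F.d_deg i) hf

theorem exists_d_eq (F : GradedFreeResolution (n := n) ℳ) (i k : ℕ) (g : F.gen (i + 1) →₀ Poly K n)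
    (hg : F.d i g ∈ freeGrading K n (F.deg i) k) :
    ∃ f ∈ freeGrading K n (F.deg (i + 1)) k, F.d i f = F.d i g :=
  exists_homogeneous_preimage (freePart (F.deg i)) (F.d i) (F.d_deg i) g hg

/-- The graded syzygy modules: the `i`-th one is the kernel in `F_i`. -/
def syzygy (F : GradedFreeResolution (n := n) ℳ) :
    (i k : ℕ) → AddSubgroup (F.gen i →₀ Poly K n)
  | 0, k => freeGrading K n (F.deg 0) k ⊓ (LinearMap.ker F.aug).toAddSubgroup
  | i + 1, k => freeGrading K n (F.deg (i + 1)) k ⊓ (LinearMap.ker (F.d i)).toAddSubgroup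

theorem syzygy_le (F : GradedFreeResolution (n := n) ℳ) (i k : ℕ) :
    F.syzygy i k ≤ freeGrading K n (F.deg i) k := by
  cases i with
  | zero => exact inf_le_left
  | succ i => exact inf_le_left

theorem d_mem_syzygy (F : GradedFreeResolution (n := n) ℳ) (i k : ℕ)
    (f : F.gen (i + 1) →₀ Poly K n) (hf : f ∈ freeGrading K n (F.deg (i + 1)) k) :
    F.d i f ∈ F.syzygy i k := by
  cases i with
  | zero => exact ⟨F.d_mem 0 k f hf, F.exact_zero.apply_apply_eq_zero f⟩
  | succ i => exact ⟨F.d_mem (i + 1) k f hf, (F.exact_succ i).apply_apply_eq_zero f⟩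

theorem exists_of_mem_syzygy (F : GradedFreeResolution (n := n) ℳ) (i k : ℕ)
    (z : F.gen i →₀ Poly K n) (hz : z ∈ F.syzygy i k) :
    ∃ f ∈ freeGrading K n (F.deg (i + 1)) k, F.d i f = z := by
  have hg : ∃ g, F.d i g = z := by
    cases i with
    | zero => exact (F.exact_zero z).mp hz.2
    | succ i => exact (F.exact_succ i z).mp hz.2
  obtain ⟨g, rfl⟩ := hg
  exact F.exists_d_eq i k g (F.syzygy_le i k hz)

theorem koszulVanishes_add_two_iff [IsGradedModule (n := n) ℳ]
    (F : GradedFreeResolution (n := n) ℳ) (i j : ℕ) :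
    KoszulVanishes (MvPolynomial.X : Fin n → Poly K n) (addGrading ℳ) (i + 2) j ↔
      KoszulVanishes (MvPolynomial.X : Fin n → Poly K n) (F.syzygy i) 1 j := by
  -- Each shift needs Koszul vanishing of a free module in two consecutive degrees. It is available
  -- only in positive degrees, so the shifting stops at first homology of the syzygy module.
  have key : ∀ p i, KoszulVanishes (MvPolynomial.X : Fin n → Poly K n) (addGrading ℳ)
      (p + 1 + i + 1) j ↔
      KoszulVanishes (MvPolynomial.X : Fin n → Poly K n) (F.syzygy i) (p + 1) j := by
    intro p i
    induction i generalizing p with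
    | zero =>
      exact koszulVanishes_shift F.aug (freeGrading_X_smul (F.deg 0))
        (fun k f hf => map_mem_of_single_mem ℳ F.aug F.aug_deg hf)
        (fun k x hx => by
          obtain ⟨g, rfl⟩ := F.aug_surjective x
          exact exists_homogeneous_preimage ℳ F.aug F.aug_deg g hx)
        (koszulVanishes_free _ _ _) (koszulVanishes_free _ _ _)
    | succ i ih =>
      rw [show p + 1 + (i + 1) + 1 = (p + 1) + 1 + i + 1 by omega, ih (p + 1)]
      exact koszulVanishes_shift (F.d i) (freeGrading_X_smul (F.deg (i + 1)))
        (F.d_mem_syzygy i) (F.exists_of_mem_syzygy i)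
        (koszulVanishes_free _ _ _) (koszulVanishes_free _ _ _)
  rw [show i + 2 = 0 + 1 + i + 1 by omega]
  exact key 0 i

end GradedFreeResolution

/-! ### Koszul homology in degrees zero and one from free presentations -/

section FreePresentation

variable {K : Type u} [Field K] {n : ℕ} {ι κ θ : Type u} {Q : Type*} [AddCommGroup Q]
  [Module (Poly K n) Q]

theorem exists_koszulD_apply_empty {deg : ι → ℕ} {j : ℕ} {f : ι →₀ Poly K n}
    (hf : f ∈ freeGrading K n deg j) (h0 : HasZeroConstants f) :
    ∃ b ∈ koszulChains (freeGrading K n deg) 1 j,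
      koszulD (MvPolynomial.X : Fin n → Poly K n) b = Pi.single ∅ f := by
  refine exists_koszulD_eq_free deg (i := 0) ?_ ?_ (by rwa [Pi.single_eq_same])
  · intro F hF
    have hFe : F = ∅ := by
      by_contra h
      exact hF (Pi.single_eq_of_ne h _)
    subst hFe
    rw [Pi.single_eq_same]
    exact ⟨rfl, j, rfl, hf⟩
  · ext1 H
    rw [koszulD_apply]
    refine Finset.sum_eq_zero fun v _ => ?_
    rw [Pi.single_eq_of_ne (Finset.insert_ne_empty v H), smul_zero]

theorem koszulChains_zero_eq_single {P : Type*} [AddCommGroup P] {𝒢 : ℕ → AddSubgroup P} {j : ℕ}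
    {c : Finset (Fin n) → P} (hc : c ∈ koszulChains 𝒢 0 j) : c = Pi.single ∅ (c ∅) := by
  ext1 F
  by_cases h : F = ∅
  · rw [h, Pi.single_eq_same]
  · rw [Pi.single_eq_of_ne h]
    by_contra hne
    exact h (Finset.card_eq_zero.mp (hc F hne).1)

theorem koszulChains_zero_apply {P : Type*} [AddCommGroup P] {𝒢 : ℕ → AddSubgroup P} {j : ℕ}
    {c : Finset (Fin n) → P} (hc : c ∈ koszulChains 𝒢 0 j) : c ∅ ∈ 𝒢 j := by
  by_cases h : c ∅ = 0
  · rw [h]; exact zero_mem _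
  · obtain ⟨-, k, hk, hm⟩ := hc ∅ h
    rwa [← hk]

/-- The first Koszul homology of a graded module in terms of a graded free presentation. -/
theorem koszulVanishes_one_iff {degP : ι → ℕ} {degP' : κ → ℕ} {degP'' : θ → ℕ}
    {ℬ : ℕ → AddSubgroup Q} (φ : (ι →₀ Poly K n) →ₗ[Poly K n] Q)
    (ψ : (κ →₀ Poly K n) →ₗ[Poly K n] (ι →₀ Poly K n))
    (ψ' : (θ →₀ Poly K n) →ₗ[Poly K n] (κ →₀ Poly K n))
    (hφ : ∀ k, ∀ p ∈ freeGrading K n degP k, φ p ∈ ℬ k)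
    (hs : ∀ k, ∀ q ∈ ℬ k, ∃ p ∈ freeGrading K n degP k, φ p = q)
    (hψ : ∀ k, ∀ p ∈ freeGrading K n degP' k, ψ p ∈ freeGrading K n degP k)
    (hφψ : ∀ p, φ (ψ p) = 0)
    (hsψ : ∀ k, ∀ p ∈ freeGrading K n degP k, φ p = 0 →
      ∃ q ∈ freeGrading K n degP' k, ψ q = p)
    (hψψ : ∀ p, ψ (ψ' p) = 0)
    (hsψ' : ∀ k, ∀ p ∈ freeGrading K n degP' k, ψ p = 0 →
      ∃ q ∈ freeGrading K n degP'' k, ψ' q = p)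
    (hψ' : ∀ k, ∀ p ∈ freeGrading K n degP'' k, ψ' p ∈ freeGrading K n degP' k) (j : ℕ) :
    KoszulVanishes (MvPolynomial.X : Fin n → Poly K n) ℬ 1 j ↔
      ∀ f ∈ freeGrading K n degP' j, HasZeroConstants (ψ f) →
        ∃ g ∈ freeGrading K n degP'' j, HasZeroConstants (f - ψ' g) := by
  rw [koszulVanishes_succ_iff φ (freeGrading_X_smul degP) hφ hs (koszulVanishes_free _ _ _)]
  constructor
  · intro h f hf hf0
    -- An element with zero constant terms is a boundary, so `ψ f` is the boundary of some `b`. A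
    -- primitive `e` inside `ker φ` lifts along `ψ`; subtracting the boundary of the lift from `f`
    -- gives an element of `ker ψ`, hence of the image of `ψ'`.
    obtain ⟨b, hb, hbe⟩ := exists_koszulD_apply_empty (hψ j f hf) hf0
    obtain ⟨e, he, hee⟩ := h b hb (by
      ext1 F
      rw [hbe]
      by_cases hF : F = ∅
      · subst hF; rw [Pi.single_eq_same, hφψ]; rfl
      · rw [Pi.single_eq_of_ne hF, map_zero]; rfl)
    obtain ⟨e', he', rfl⟩ := exists_lift_koszulChains (𝒜 := freeGrading K n degP')
      (ℬ := fun k => freeGrading K n degP k ⊓ (LinearMap.ker φ).toAddSubgroup) ψ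
      (fun k q hq => hsψ k q hq.1 hq.2) he
    rw [koszulD_map, hbe] at hee
    have h1 : ψ (koszulD (MvPolynomial.X (R := K)) e' ∅) = ψ f := by
      have := congrFun hee ∅
      rwa [Pi.single_eq_same] at this
    have h2 := koszulChains_zero_apply (koszulD_mem (freeGrading_X_smul degP') he')
    obtain ⟨g, hg, hge⟩ := hsψ' j (f - koszulD (MvPolynomial.X (R := K)) e' ∅) (sub_mem hf h2)
      (by rw [map_sub, h1, sub_self])
    refine ⟨g, hg, ?_⟩
    rw [hge, sub_sub_cancel]
    exact hasZeroConstants_koszulD _ _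
  · intro h b hb hb0
    -- The same construction reversed: the boundary of `b` is `ψ f`, and modulo the image of `ψ'`
    -- the element `f` is itself a boundary. The image under `ψ` of its primitive lies in `ker φ`.
    have h2 := koszulD_mem (freeGrading_X_smul degP) hb
    obtain ⟨f, hf, hfe⟩ := hsψ j _ (koszulChains_zero_apply h2) (congrFun hb0 ∅)
    obtain ⟨g, hg, hg0⟩ := h f hf (by rw [hfe]; exact hasZeroConstants_koszulD _ _)
    obtain ⟨e, he, hee⟩ := exists_koszulD_apply_empty (sub_mem hf (hψ' j g hg)) hg0
    refine ⟨_, koszulChains_inf_ker φ (map_mem_koszulChains ψ hψ he) ?_, ?_⟩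
    · ext1 F
      exact hφψ _
    · rw [koszulD_map, hee, koszulChains_zero_eq_single h2]
      ext1 F
      by_cases hF : F = ∅
      · subst hF; rw [Pi.single_eq_same, Pi.single_eq_same, map_sub, hψψ, sub_zero, hfe]
      · rw [Pi.single_eq_of_ne hF, Pi.single_eq_of_ne hF, map_zero]

end FreePresentation

namespace GradedFreeResolution

variable {K : Type u} [Field K] {n : ℕ} {M : Type u} [AddCommGroup M]
  [Module (Poly K n) M] [Module K M] {ℳ : ℕ → Submodule K M} [hM : IsGradedModule (n := n) ℳ]

/-- `Tor` vanishes exactly where Koszul homology does. -/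
theorem tor_subsingleton_iff_koszulVanishes (F : GradedFreeResolution (n := n) ℳ) (i j : ℕ) :
    Subsingleton (F.Tor i j) ↔
      KoszulVanishes (MvPolynomial.X : Fin n → Poly K n) (addGrading ℳ) i j := by
  have haug : ∀ k, ∀ p ∈ freeGrading K n (F.deg 0) k, F.aug p ∈ addGrading ℳ k :=
    fun k f hf => map_mem_of_single_mem ℳ F.aug F.aug_deg hf
  have hsaug : ∀ k, ∀ q ∈ addGrading ℳ k, ∃ p ∈ freeGrading K n (F.deg 0) k, F.aug p = q := by
    intro k x hx
    obtain ⟨g, rfl⟩ := F.aug_surjective x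
    exact exists_homogeneous_preimage ℳ F.aug F.aug_deg g hx
  match i with
  | 0 =>
    rw [tor_zero_subsingleton_iff]
    constructor
    · intro h c hc _
      obtain ⟨c', hc', rfl⟩ := exists_lift_koszulChains F.aug hsaug hc
      obtain ⟨g, hg, hg0⟩ := h _ (koszulChains_zero_apply hc')
      obtain ⟨b, hb, hbe⟩ := exists_koszulD_apply_empty
        (sub_mem (koszulChains_zero_apply hc') (F.d_mem 0 j g hg)) hg0
      refine ⟨_, map_mem_koszulChains F.aug haug hb, ?_⟩
      rw [koszulD_map, hbe, koszulChains_zero_eq_single hc]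
      ext1 H
      by_cases hH : H = ∅
      · subst hH
        rw [Pi.single_eq_same, Pi.single_eq_same, map_sub, F.exact_zero.apply_apply_eq_zero,
          sub_zero]
      · rw [Pi.single_eq_of_ne hH, Pi.single_eq_of_ne hH, map_zero]
    · intro h f hf
      obtain ⟨b, hb, hbe⟩ := h (Pi.single ∅ (F.aug f)) (by
        intro H hH
        have hHe : H = ∅ := by
          by_contra h
          exact hH (Pi.single_eq_of_ne h _)
        subst hHe
        rw [Pi.single_eq_same]
        exact ⟨rfl, j, rfl, haug j f hf⟩) (by
        ext1 H
        rw [koszulD_apply]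
        refine Finset.sum_eq_zero fun v _ => ?_
        rw [Pi.single_eq_of_ne (Finset.insert_ne_empty v H), smul_zero])
      obtain ⟨b', hb', rfl⟩ := exists_lift_koszulChains F.aug hsaug hb
      rw [koszulD_map] at hbe
      have h1 := congrFun hbe ∅
      rw [Pi.single_eq_same] at h1
      have h2 := koszulChains_zero_apply (koszulD_mem (freeGrading_X_smul (F.deg 0)) hb')
      obtain ⟨g, hg, hge⟩ := F.exists_of_mem_syzygy 0 j
        (f - koszulD (MvPolynomial.X (R := K)) b' ∅) ⟨AddSubgroup.sub_mem _ hf h2, by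
          change F.aug _ = 0
          rw [map_sub, h1, sub_self]⟩
      refine ⟨g, hg, ?_⟩
      rw [hge, sub_sub_cancel]
      exact hasZeroConstants_koszulD _ _
  | 1 =>
    rw [tor_succ_subsingleton_iff]
    exact (koszulVanishes_one_iff F.aug (F.d 0) (F.d 1) haug hsaug (F.d_mem 0)
      F.exact_zero.apply_apply_eq_zero (fun k p hp h0 => F.exists_of_mem_syzygy 0 k p ⟨hp, h0⟩)
      (F.exact_succ 0).apply_apply_eq_zero
      (fun k p hp h0 => F.exists_of_mem_syzygy 1 k p ⟨hp, h0⟩) (F.d_mem 1) j).symm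
  | i + 2 =>
    rw [tor_succ_subsingleton_iff, F.koszulVanishes_add_two_iff]
    exact (koszulVanishes_one_iff (F.d i) (F.d (i + 1)) (F.d (i + 2)) (F.d_mem_syzygy i)
      (F.exists_of_mem_syzygy i) (F.d_mem (i + 1)) (F.exact_succ i).apply_apply_eq_zero
      (fun k p hp h0 => F.exists_of_mem_syzygy (i + 1) k p ⟨hp, h0⟩)
      (F.exact_succ (i + 1)).apply_apply_eq_zero
      (fun k p hp h0 => F.exists_of_mem_syzygy (i + 2) k p ⟨hp, h0⟩) (F.d_mem (i + 2)) j).symm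

end GradedFreeResolution

/-! ### Linear resolutions in terms of Koszul homology -/

theorem betti_eq_zero_iff {K : Type u} [Field K] {n : ℕ} {M : Type u} [AddCommGroup M]
    [Module (Poly K n) M] [Module K M] (ℳ : ℕ → Submodule K M) [IsGradedModule (n := n) ℳ]
    (i j : ℕ) : betti (n := n) ℳ i j = 0 ↔
      KoszulVanishes (MvPolynomial.X : Fin n → Poly K n) (addGrading ℳ) i j := by
  rw [betti, rank_zero_iff, GradedFreeResolution.tor_subsingleton_iff_koszulVanishes]

/-- A nonzero element of the initial degree `d` cannot be a combination of variables times elements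
of lower degree, so `β_{0,d} ≠ 0` and the regularity is at least `d`. Only the upper bound remains
as a condition. -/
theorem hasLinearResolution_iff {K : Type u} [Field K] {n : ℕ} {M : Type u} [AddCommGroup M]
    [Module (Poly K n) M] [Module K M] (ℳ : ℕ → Submodule K M) [IsGradedModule (n := n) ℳ]
    {d : ℕ} (hd : indeg ℳ = (d : ℕ∞)) : HasLinearResolution (n := n) ℳ d ↔
      ∀ i j, i + d < j →
        KoszulVanishes (MvPolynomial.X : Fin n → Poly K n) (addGrading ℳ) i j := by
  have hbot : ∀ k, k < d → ℳ k = ⊥ := by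
    intro k hk
    by_contra hne
    have : indeg ℳ ≤ (k : ℕ∞) := sInf_le ⟨k, hne, rfl⟩
    rw [hd, Nat.cast_le] at this
    omega
  have hne : ℳ d ≠ ⊥ := by
    intro h0
    have h1 : ((d + 1 : ℕ) : ℕ∞) ≤ indeg ℳ := by
      refine le_sInf ?_
      rintro _ ⟨j, hj, rfl⟩
      rw [Nat.cast_le]
      by_contra hlt
      rcases (by omega : j < d ∨ j = d) with h | rfl
      · exact hj (hbot j h)
      · exact hj h0
    rw [hd, Nat.cast_le] at h1
    omega
  have hbetti : betti (n := n) ℳ 0 d ≠ 0 := by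
    rw [Ne, betti_eq_zero_iff]
    intro h
    obtain ⟨x, hx, hx0⟩ := Submodule.exists_mem_ne_zero_of_ne_bot hne
    obtain ⟨b, hb, hbe⟩ := h (Pi.single ∅ x) (by
      intro H hH
      have hHe : H = ∅ := by
        by_contra h
        exact hH (Pi.single_eq_of_ne h _)
      subst hHe
      rw [Pi.single_eq_same]
      exact ⟨rfl, d, rfl, hx⟩) (by
      ext1 H
      rw [koszulD_apply]
      refine Finset.sum_eq_zero fun v _ => ?_
      rw [Pi.single_eq_of_ne (Finset.insert_ne_empty v H), smul_zero])
    have hb0 : b = 0 := by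
      ext1 F
      by_contra hF
      obtain ⟨-, k, hk, hm⟩ := hb F hF
      have hm' : b F ∈ ℳ k := hm
      rw [hbot k (by omega)] at hm'
      exact hF hm'
    rw [hb0, map_zero] at hbe
    have := congrFun hbe ∅
    rw [Pi.single_eq_same] at this
    exact hx0 this.symm
  simp only [HasLinearResolution, hd, and_true, ← betti_eq_zero_iff]
  constructor
  · intro h i j hij
    by_contra hb
    have : (((j : ℝ) - (i : ℝ) : ℝ) : EReal) ≤ regularity (n := n) ℳ := le_sSup ⟨i, j, hb, rfl⟩
    rw [h, EReal.coe_le_coe_iff] at this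
    have h2 : ((i + d : ℕ) : ℝ) < (j : ℝ) := Nat.cast_lt.mpr hij
    push_cast at h2
    linarith
  · intro h
    refine le_antisymm (sSup_le ?_) (le_sSup ⟨0, d, hbetti, by simp⟩)
    rintro _ ⟨i, j, hb, rfl⟩
    rw [EReal.coe_le_coe_iff]
    have hij : j ≤ i + d := by
      by_contra hlt
      exact hb (h i j (by omega))
    have h2 : (j : ℝ) ≤ ((i + d : ℕ) : ℝ) := Nat.cast_le.mpr hij
    push_cast at h2
    linarith

/-! ### The Koszul complex of a Stanley–Reisner ideal -/

section StanleyReisner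

variable {K : Type u} [Field K] {n : ℕ} {Δ : AbstractSimplicialComplex (Fin n)}

theorem IsFace.mono {F G : Finset (Fin n)} (hG : IsFace Δ G) (h : F ⊆ G) : IsFace Δ F := by
  by_cases hF : F = ∅
  · exact Or.inl hF
  · right
    rcases hG with rfl | hG
    · exact absurd (Finset.subset_empty.mp h) hF
    · exact (Δ.isRelLowerSet_faces hG).2 h (Finset.nonempty_iff_ne_empty.mpr hF)

theorem prod_X_eq_monomial (F : Finset (Fin n)) :
    ∏ i ∈ F, (MvPolynomial.X i : Poly K n) = MvPolynomial.monomial (indicatorExp F) 1 := by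
  rw [indicatorExp, MvPolynomial.monomial_sum_one]
  rfl

theorem mem_stanleyReisnerIdeal_iff {f : Poly K n} :
    f ∈ stanleyReisnerIdeal K Δ ↔ ∀ m, f.coeff m ≠ 0 → ¬ IsFace Δ m.support := by
  have h : {f : Poly K n | ∃ F : Finset (Fin n), ¬ IsFace Δ F ∧ f = ∏ i ∈ F, MvPolynomial.X i} =
      (fun s => MvPolynomial.monomial s (1 : K)) '' (indicatorExp '' {F | ¬ IsFace Δ F}) := by
    rw [Set.image_image]
    ext f
    simp only [prod_X_eq_monomial, Set.mem_ofPred_eq, Set.mem_image]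
    exact exists_congr fun F => and_congr_right fun _ => eq_comm
  rw [stanleyReisnerIdeal, h, MvPolynomial.mem_ideal_span_monomial_image]
  refine forall_congr' fun m => ?_
  rw [MvPolynomial.mem_support_iff]
  refine imp_congr_right fun _ => ?_
  constructor
  · rintro ⟨_, ⟨F, hF, rfl⟩, hle⟩ hm
    rw [indicatorExp_le_iff] at hle
    exact hF (hm.mono fun v hv => Finsupp.mem_support_iff.mpr (hle v hv))
  · intro hm
    exact ⟨_, ⟨_, hm, rfl⟩, indicatorExp_le_iff.mpr fun v hv => Finsupp.mem_support_iff.mp hv⟩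

theorem mem_addGrading_idealPart {I : Ideal (Poly K n)} {k : ℕ} {f : I} :
    f ∈ addGrading (idealPart I) k ↔ ∀ m, (f : Poly K n).coeff m ≠ 0 → m.degree = k := by
  change MvPolynomial.IsHomogeneous (f : Poly K n) k ↔ _
  have hw : ∀ m : Fin n →₀ ℕ, Finsupp.weight (1 : Fin n → ℕ) m = m.degree := by
    intro m
    rw [Finsupp.degree_eq_weight_one]
    rfl
  constructor
  · intro h m hm
    rw [← hw]
    exact h hm
  · intro h m hm
    rw [hw]
    exact h m hm

theorem card_le_of_dimension {d : ℕ} (hdim : dimension Δ = (d : ℤ) - 1) {F : Finset (Fin n)}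
    (hF : IsFace Δ F) : F.card ≤ d := by
  classical
  have h : F.card ≤ (Finset.univ.filter fun F => IsFace Δ F).sup Finset.card :=
    Finset.le_sup (f := Finset.card) (Finset.mem_filter.mpr ⟨Finset.mem_univ F, hF⟩)
  rw [dimension] at hdim
  have h2 : (Finset.univ.filter fun F => IsFace Δ F).sup Finset.card = d := by
    have : ∀ s : ℕ, (s : ℤ) - 1 = (d : ℤ) - 1 → s = d := by omega
    exact this _ (by convert hdim)
  omega

/-- If all subsets were faces, the ideal would be zero and its initial degree `⊤`. This excludes the
full simplex. -/
theorem exists_not_isFace_of_indeg {d : ℕ}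
    (hindeg : indeg (idealPart (stanleyReisnerIdeal K Δ)) = (d : ℕ∞)) : ∃ F, ¬ IsFace Δ F := by
  by_contra h
  push Not at h
  have h1 : indeg (idealPart (stanleyReisnerIdeal K Δ)) = ⊤ := by
    refine sInf_eq_top.mpr ?_
    rintro _ ⟨j, hj, rfl⟩
    refine absurd ?_ hj
    rw [eq_bot_iff]
    intro f _
    refine Subtype.ext (MvPolynomial.ext _ _ fun m => ?_)
    by_contra hne
    exact mem_stanleyReisnerIdeal_iff.mp f.2 m hne (h _)
  rw [h1] at hindeg
  exact ENat.top_ne_natCast d hindeg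

/-- Exactness of the multidegree `a` part of the Koszul complex of the Stanley–Reisner ideal in
homological degree `i`. -/
def MultiVanishes (K : Type u) [Field K] (Δ : AbstractSimplicialComplex (Fin n)) (i : ℕ)
    (a : Fin n →₀ ℕ) : Prop :=
  ∀ u : Finset (Fin n) → K, koszulD (fun _ => (1 : K)) u = 0 →
    (∀ F, u F ≠ 0 → F.card = i ∧ indicatorExp F ≤ a ∧ ¬ IsFace Δ (a - indicatorExp F).support) →
    ∃ b : Finset (Fin n) → K, koszulD (fun _ => (1 : K)) b = u ∧
      ∀ F, b F ≠ 0 → F.card = i + 1 ∧ indicatorExp F ≤ a ∧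
        ¬ IsFace Δ (a - indicatorExp F).support

theorem koszulVanishes_of_multiVanishes {i j : ℕ} (h : ∀ a, a.degree = j → MultiVanishes K Δ i a) :
    KoszulVanishes (MvPolynomial.X : Fin n → Poly K n)
      (addGrading (idealPart (stanleyReisnerIdeal K Δ))) i j := by
  intro c hc hc0
  have hval : koszulD (MvPolynomial.X : Fin n → Poly K n) (fun F => (c F : Poly K n)) = 0 := by
    refine (koszulD_map (MvPolynomial.X (R := K)) (stanleyReisnerIdeal K Δ).subtype c).trans ?_
    rw [hc0]
    rfl
  have hcm : ∀ F m, (c F : Poly K n).coeff m ≠ 0 →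
      F.card = i ∧ m.degree + i = j ∧ ¬ IsFace Δ m.support := by
    intro F m hm
    obtain ⟨hi, k, hk, hm'⟩ := hc F (by intro h0; simp [h0] at hm)
    rw [mem_addGrading_idealPart] at hm'
    exact ⟨hi, by rw [hm' m hm, hk], mem_stanleyReisnerIdeal_iff.mp (c F).2 m hm⟩
  obtain ⟨b, hb, hp⟩ := exists_koszulD_eq_of_multiPart (fun F => (c F : Poly K n))
    (fun F a => a.degree = j ∧ F.card = i + 1 ∧ ¬ IsFace Δ (a - indicatorExp F).support) (by
    intro a
    by_cases ha : a.degree = j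
    · obtain ⟨b, hb, hbF⟩ := h a ha _ (koszulD_multiPart_eq_zero hval a) (by
        intro F hF
        obtain ⟨h1, h2⟩ := multiPart_ne_zero hF
        obtain ⟨h3, -, h4⟩ := hcm _ _ h2
        exact ⟨h3, h1, h4⟩)
      exact ⟨b, hb, fun F hF => ⟨(hbF F hF).2.1, ha, (hbF F hF).1, (hbF F hF).2.2⟩⟩
    · refine ⟨0, ?_, fun F h => absurd rfl h⟩
      rw [map_zero]
      symm
      ext F
      by_contra hF
      obtain ⟨h1, h2⟩ := multiPart_ne_zero hF
      obtain ⟨h3, h4, -⟩ := hcm _ _ h2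
      rw [← h3, degree_add_card h1] at h4
      exact ha h4)
  have hbI : ∀ F, b F ∈ stanleyReisnerIdeal K Δ := by
    intro F
    rw [mem_stanleyReisnerIdeal_iff]
    intro m hm
    have := (hp F m hm).2.2
    rwa [add_tsub_cancel_right] at this
  refine ⟨fun F => ⟨b F, hbI F⟩, ?_, ?_⟩
  · intro F hF
    have hF' : b F ≠ 0 := fun h0 => hF (Subtype.ext h0)
    have key : ∀ m, (b F).coeff m ≠ 0 → F.card = i + 1 ∧ m.degree + (i + 1) = j := by
      intro m hm
      obtain ⟨h1, h2, -⟩ := hp F m hm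
      rw [map_add, degree_indicatorExp, h2] at h1
      exact ⟨h2, h1⟩
    obtain ⟨m, hm⟩ := MvPolynomial.ne_zero_iff.mp hF'
    obtain ⟨h1, h2⟩ := key m hm
    refine ⟨h1, m.degree, h2, ?_⟩
    rw [mem_addGrading_idealPart]
    intro m' hm'
    have := (key m' hm').2
    omega
  · ext1 F
    refine Subtype.ext ?_
    have h1 := congrFun (koszulD_map (MvPolynomial.X (R := K)) (stanleyReisnerIdeal K Δ).subtype
      (fun F => ⟨b F, hbI F⟩)) F
    exact h1.symm.trans (congrFun hb F)

theorem multiVanishes_of_koszulVanishes {i : ℕ} {a : Fin n →₀ ℕ}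
    (h : KoszulVanishes (MvPolynomial.X : Fin n → Poly K n)
      (addGrading (idealPart (stanleyReisnerIdeal K Δ))) i a.degree) : MultiVanishes K Δ i a := by
  classical
  intro u hu0 hu
  let c : Finset (Fin n) → Poly K n := fun F => MvPolynomial.monomial (a - indicatorExp F) (u F)
  have hcoeff : ∀ F m, (c F).coeff m ≠ 0 → u F ≠ 0 ∧ a - indicatorExp F = m := by
    intro F m hm
    rw [MvPolynomial.coeff_monomial] at hm
    split_ifs at hm with h1
    · exact ⟨hm, h1⟩
    · exact absurd rfl hm
  have hcI : ∀ F, c F ∈ stanleyReisnerIdeal K Δ := by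
    intro F
    rw [mem_stanleyReisnerIdeal_iff]
    intro m hm
    obtain ⟨h1, rfl⟩ := hcoeff F m hm
    exact (hu F h1).2.2
  -- The polynomial chain `c` is `u` placed in multidegree `a` alone, so a primitive of `c`
  -- restricts to a primitive of `u` in that multidegree.
  have hpart : ∀ a', multiPart c a' = if a' = a then u else 0 := by
    intro a'
    ext F
    rw [multiPart]
    by_cases huF : u F = 0
    · have : c F = 0 := by simp [c, huF]
      rw [this]
      split_ifs
      all_goals simp [huF]
    · have hle := (hu F huF).2.1
      split_ifs with h1 h2 h2
      · rw [h2, MvPolynomial.coeff_monomial, if_pos rfl]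
      · rw [MvPolynomial.coeff_monomial, if_neg]
        · rfl
        · intro he
          apply h2
          rw [← tsub_add_cancel_of_le h1, ← he, tsub_add_cancel_of_le hle]
      · exact absurd (h2 ▸ hle) h1
      · rfl
  have hc0 : koszulD (MvPolynomial.X : Fin n → Poly K n) c = 0 := by
    ext F m
    rw [← multiPart_add_indicatorExp, multiPart_koszulD, hpart]
    split_ifs
    · rw [hu0]; simp
    · rw [map_zero]; simp
  obtain ⟨b, hb, hbe⟩ := h (fun F => ⟨c F, hcI F⟩) (by
    intro F hF
    have huF : u F ≠ 0 := fun h0 => hF (Subtype.ext (by simp [c, h0]))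
    obtain ⟨h1, h2, -⟩ := hu F huF
    refine ⟨h1, (a - indicatorExp F).degree, by rw [← h1, degree_add_card h2], ?_⟩
    rw [mem_addGrading_idealPart]
    intro m hm
    rw [← (hcoeff F m hm).2]) (by
    ext1 F
    refine Subtype.ext ?_
    have h1 := congrFun (koszulD_map (MvPolynomial.X (R := K)) (stanleyReisnerIdeal K Δ).subtype
      (fun F => ⟨c F, hcI F⟩)) F
    exact h1.symm.trans (congrFun hc0 F))
  refine ⟨multiPart (fun F => (b F : Poly K n)) a, ?_, ?_⟩
  · rw [← multiPart_koszulD]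
    have h1 := koszulD_map (MvPolynomial.X (R := K)) (stanleyReisnerIdeal K Δ).subtype b
    have h2 : koszulD (MvPolynomial.X (R := K)) (fun F => (b F : Poly K n)) = c := by
      refine h1.trans ?_
      rw [hbe]
      rfl
    rw [h2, hpart, if_pos rfl]
  · intro F hF
    obtain ⟨h1, h2⟩ := multiPart_ne_zero hF
    exact ⟨(hb F (by intro h0; simp [h0] at h2)).1, h1,
      mem_stanleyReisnerIdeal_iff.mp (b F).2 _ h2⟩

/-- With exponent at least two at `v`, adding `v` to `F` leaves the support of `a - indicatorExp F`
unchanged. The cone with apex `v` therefore stays within the ideal. -/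
theorem multiVanishes_of_two_le {i : ℕ} {a : Fin n →₀ ℕ} {v : Fin n} (hv : 2 ≤ a v) :
    MultiVanishes K Δ i a := by
  intro u hu0 hu
  refine ⟨cone v u, koszulD_cone_of_cycle v hu0, fun F hF => ?_⟩
  obtain ⟨hvF, hne⟩ := cone_ne_zero hF
  obtain ⟨h1, h2, h3⟩ := hu _ hne
  refine ⟨by rw [← Finset.card_erase_add_one hvF, h1], ?_, ?_⟩
  · rw [indicatorExp_le_iff] at h2 ⊢
    intro w hw
    by_cases h : w = v
    · rw [h]; omega
    · exact h2 w (Finset.mem_erase.mpr ⟨h, hw⟩)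
  · convert h3 using 2
    ext w
    simp only [Finsupp.mem_support_iff, Finsupp.tsub_apply, indicatorExp_apply, Finset.mem_erase]
    by_cases h : w = v
    · subst h
      simp only [ne_eq, not_true_eq_false, false_and, if_false]
      split_ifs
      all_goals omega
    · simp [h]

theorem indicatorExp_le_indicatorExp {F W : Finset (Fin n)} :
    indicatorExp F ≤ indicatorExp W ↔ F ⊆ W := by
  rw [indicatorExp_le_iff]
  refine forall₂_congr fun v _ => ?_
  rw [indicatorExp_apply]
  simp

theorem support_indicatorExp_sub (F W : Finset (Fin n)) :
    (indicatorExp W - indicatorExp F).support = W \ F := by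
  ext v
  rw [Finsupp.mem_support_iff, Finsupp.tsub_apply, indicatorExp_apply, indicatorExp_apply,
    Finset.mem_sdiff]
  split_ifs
  all_goals simp_all

theorem multiVanishes_indicatorExp_iff {i : ℕ} {W : Finset (Fin n)} :
    MultiVanishes K Δ i (indicatorExp W) ↔
      ∀ u : Finset (Fin n) → K, koszulD (fun _ => (1 : K)) u = 0 →
        (∀ F, u F ≠ 0 → F.card = i ∧ F ⊆ W ∧ ¬ IsFace Δ (W \ F)) →
        ∃ b : Finset (Fin n) → K, koszulD (fun _ => (1 : K)) b = u ∧
          ∀ F, b F ≠ 0 → F.card = i + 1 ∧ F ⊆ W ∧ ¬ IsFace Δ (W \ F) := by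
  simp only [MultiVanishes, indicatorExp_le_indicatorExp, support_indicatorExp_sub]

theorem eq_indicatorExp_support {a : Fin n →₀ ℕ} (h : ∀ v, a v < 2) :
    a = indicatorExp a.support := by
  ext v
  rw [indicatorExp_apply]
  have := h v
  split_ifs with hv
  · rw [Finsupp.mem_support_iff] at hv; omega
  · simpa using hv

end StanleyReisner

/-! ### Combinatorial Alexander duality -/

section Duality

variable {K : Type u} [Field K] {n : ℕ}

/-- The sign of the complementation `F ↦ W \ F`. -/
def starSign (K : Type u) [Field K] (W F : Finset (Fin n)) : K := ∏ w ∈ F, faceSign K W w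

theorem starSign_mul_self (W F : Finset (Fin n)) : starSign K W F * starSign K W F = 1 := by
  rw [starSign, ← Finset.prod_mul_distrib]
  exact Finset.prod_eq_one fun w _ => faceSign_mul_self W w

theorem faceSign_mul_faceSign_sdiff {W H : Finset (Fin n)} (h : H ⊆ W) (v : Fin n) :
    faceSign K H v * faceSign K (W \ H) v = faceSign K W v := by
  rw [faceSign, faceSign, faceSign, ← pow_add, ← Finset.card_union_of_disjoint,
    ← Finset.filter_union, Finset.union_sdiff_of_subset h]
  exact Finset.disjoint_filter_filter Finset.disjoint_sdiff

/-- Summation by parts: the inner sum on the right is the coboundary of `y`. -/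
theorem sum_mul_koszulD (y a : Finset (Fin n) → K) :
    ∑ F, y F * koszulD (fun _ => (1 : K)) a F =
      ∑ H, a H * ∑ v ∈ H, faceSign K H v * y (H.erase v) := by
  simp only [koszulD_apply, Finset.mul_sum]
  rw [Finset.sum_sigma', Finset.sum_sigma']
  refine Finset.sum_bij' (fun p _ => ⟨insert p.2 p.1, p.2⟩) (fun p _ => ⟨p.1.erase p.2, p.2⟩)
    ?_ ?_ ?_ ?_ ?_
  · rintro ⟨F, v⟩ _
    simp
  · rintro ⟨F, v⟩ _
    simp
  · rintro ⟨F, v⟩ h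
    have hv : v ∉ F := by simpa using h
    simp [Finset.erase_insert hv]
  · rintro ⟨F, v⟩ h
    have hv : v ∈ F := by simpa using h
    simp [Finset.insert_erase hv]
  · rintro ⟨F, v⟩ h
    have hv : v ∉ F := by simpa using h
    dsimp only
    rw [Finset.erase_insert hv, ← faceSign_erase (F := insert v F), Finset.erase_insert hv,
      smul_eq_mul]
    ring

/-- Signed complementation carries boundary to coboundary. The signs match because the elements of
`W` below `v` split into those in `H` and those in `W \ H`. -/
theorem sum_starSign_mul {W H : Finset (Fin n)} (hH : H ⊆ W) {z : Finset (Fin n) → K}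
    (hz : ∀ G, z G ≠ 0 → G ⊆ W) :
    ∑ v ∈ H, faceSign K H v * (starSign K W (H.erase v) * z (W \ H.erase v)) =
      starSign K W H * koszulD (fun _ => (1 : K)) z (W \ H) := by
  have h1 : koszulD (fun _ => (1 : K)) z (W \ H) =
      ∑ v ∈ H, faceSign K (W \ H) v * z (insert v (W \ H)) := by
    rw [koszulD_apply]
    simp only [mul_one, smul_eq_mul]
    symm
    refine Finset.sum_subset (fun v hv => ?_) fun v hv hvH => ?_
    · simp [hv]
    · have hvW : v ∉ W := by
        simp only [Finset.mem_compl, Finset.mem_sdiff, not_and, not_not] at hv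
        exact fun h => hvH (hv h)
      have : z (insert v (W \ H)) = 0 := by
        by_contra hne
        exact hvW (hz _ hne (Finset.mem_insert_self _ _))
      rw [this, mul_zero]
  rw [h1, Finset.mul_sum]
  refine Finset.sum_congr rfl fun v hv => ?_
  have h2 : W \ H.erase v = insert v (W \ H) := by
    ext w
    by_cases h : w = v
    · subst h; simp [hH hv]
    · simp [h]
  have h3 : starSign K W H = faceSign K W v * starSign K W (H.erase v) :=
    (Finset.mul_prod_erase H _ hv).symm
  have h4 := faceSign_mul_faceSign_sdiff (K := K) hH v
  have h5 := faceSign_mul_self (R := K) (W \ H) v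
  rw [h2, h3, ← h4]
  linear_combination (-(faceSign K H v * starSign K W (H.erase v) * z (insert v (W \ H)))) * h5

theorem sum_star_mul_koszulD_eq_zero {W : Finset (Fin n)} {z : Finset (Fin n) → K}
    (hz : ∀ G, z G ≠ 0 → G ⊆ W) (hz0 : koszulD (fun _ => (1 : K)) z = 0)
    {a : Finset (Fin n) → K} (ha : ∀ H, a H ≠ 0 → H ⊆ W) :
    ∑ F, starSign K W F * z (W \ F) * koszulD (fun _ => (1 : K)) a F = 0 := by
  rw [sum_mul_koszulD (fun F => starSign K W F * z (W \ F))]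
  refine Finset.sum_eq_zero fun H _ => ?_
  by_cases h : a H = 0
  · rw [h, zero_mul]
  · rw [sum_starSign_mul (ha H h) hz, hz0]
    simp

/-- The functions on the subsets of `[n]` that are supported on the sets satisfying `p`. -/
def supportedOn (K : Type u) [Field K] (p : Finset (Fin n) → Prop) :
    Submodule K (Finset (Fin n) → K) where
  carrier := {c | ∀ F, c F ≠ 0 → p F}
  zero_mem' := fun F h => absurd rfl h
  add_mem' := by
    intro c c' hc hc' F h
    by_cases h1 : c F = 0
    · exact hc' F fun h2 => h (by simp [h1, h2])
    · exact hc F h1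
  smul_mem' := fun r c hc F h => hc F fun h1 => h (by simp [h1])

/-- If no nonzero cycle is supported on the sets with property `p`, then modulo boundaries every
chain can be changed to vanish on their complements in `W`. -/
theorem exists_koszulD_add_eq {p : Finset (Fin n) → Prop} {W : Finset (Fin n)} {i : ℕ}
    (hp : ∀ z : Finset (Fin n) → K, (∀ G, z G ≠ 0 → p G) → koszulD (fun _ => (1 : K)) z = 0 →
      z = 0) (hcard : ∀ G, G ⊆ W → p G → (W \ G).card = i) (b : Finset (Fin n) → K) :
    ∃ a g : Finset (Fin n) → K, (∀ H, a H ≠ 0 → H ⊆ W ∧ H.card = i + 1) ∧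
      (∀ F, g F ≠ 0 → ¬ (F ⊆ W ∧ p (W \ F))) ∧ koszulD (fun _ => (1 : K)) a + g = b := by
  classical
  let A := supportedOn K fun H : Finset (Fin n) => H ⊆ W ∧ H.card = i + 1
  let V := supportedOn K fun F : Finset (Fin n) => ¬ (F ⊆ W ∧ p (W \ F))
  suffices hT : A.map (koszulD (fun _ => (1 : K))) ⊔ V = ⊤ by
    have hb : b ∈ A.map (koszulD (fun _ => (1 : K))) ⊔ V := by rw [hT]; trivial
    obtain ⟨_, ⟨a, ha, rfl⟩, g, hg, hab⟩ := Submodule.mem_sup.mp hb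
    exact ⟨a, g, ha, hg, hab⟩
  by_contra hT
  -- If the claim failed, a nonzero functional would kill both summands. Killing `V` restricts its
  -- coefficients to complements of sets with property `p`; killing boundaries makes its signed
  -- complement `z` a cycle. The hypothesis `hp` then gives `z = 0`, hence `f = 0`.
  obtain ⟨f, hf, hle⟩ := Submodule.exists_le_ker_of_lt_top _ (lt_top_iff_ne_top.mpr hT)
  let y : Finset (Fin n) → K := fun F => f (Pi.single F 1)
  have hfy : ∀ g, f g = ∑ F, y F * g F := by
    intro g
    conv_lhs => rw [pi_eq_sum_univ' g, map_sum]
    refine Finset.sum_congr rfl fun F _ => ?_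
    rw [map_smul, smul_eq_mul, mul_comm]
  have hy : ∀ F, y F ≠ 0 → F ⊆ W ∧ p (W \ F) := by
    intro F hF
    by_contra hn
    refine hF (hle (Submodule.mem_sup_right fun G hG => ?_))
    have : G = F := by
      by_contra h
      exact hG (Pi.single_eq_of_ne h _)
    rwa [this]
  let z : Finset (Fin n) → K := fun G => if G ⊆ W then starSign K W (W \ G) * y (W \ G) else 0
  have hzW : ∀ G, z G ≠ 0 → G ⊆ W := by
    intro G hG
    by_contra h
    exact hG (if_neg h)
  have hzy : ∀ F, F ⊆ W → starSign K W F * z (W \ F) = y F := by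
    intro F hF
    simp only [z]
    rw [if_pos Finset.sdiff_subset, Finset.sdiff_sdiff_eq_self hF, ← mul_assoc, starSign_mul_self,
      one_mul]
  have hzp : ∀ G, z G ≠ 0 → p G := by
    intro G hG
    have hGW := hzW G hG
    simp only [z] at hG
    rw [if_pos hGW] at hG
    have := (hy _ (right_ne_zero_of_mul hG)).2
    rwa [Finset.sdiff_sdiff_eq_self hGW] at this
  have hyc : ∀ F, y F ≠ 0 → F.card = i := by
    intro F hF
    obtain ⟨h1, h2⟩ := hy F hF
    have := hcard _ Finset.sdiff_subset h2
    rwa [Finset.sdiff_sdiff_eq_self h1] at this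
  have hz0 : koszulD (fun _ => (1 : K)) z = 0 := by
    ext X
    by_cases hX : X ⊆ W
    · have h1 := sum_starSign_mul (K := K) (Finset.sdiff_subset (s := W) (t := X)) hzW
      rw [Finset.sdiff_sdiff_eq_self hX] at h1
      have h2 : ∑ v ∈ W \ X, faceSign K (W \ X) v *
          (starSign K W ((W \ X).erase v) * z (W \ (W \ X).erase v)) = 0 := by
        have h3 : ∀ v ∈ W \ X, faceSign K (W \ X) v *
            (starSign K W ((W \ X).erase v) * z (W \ (W \ X).erase v)) =
            faceSign K (W \ X) v * y ((W \ X).erase v) := fun v _ => by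
          rw [hzy _ ((Finset.erase_subset _ _).trans Finset.sdiff_subset)]
        rw [Finset.sum_congr rfl h3]
        by_cases hc : (W \ X).card = i + 1
        · have h4 : f (koszulD (fun _ => (1 : K)) (Pi.single (W \ X) 1)) = 0 := by
            refine hle (Submodule.mem_sup_left ⟨_, fun G hG => ?_, rfl⟩)
            have : G = W \ X := by
              by_contra h
              exact hG (Pi.single_eq_of_ne h _)
            rw [this]
            exact ⟨Finset.sdiff_subset, hc⟩
          rw [hfy, sum_mul_koszulD, Finset.sum_eq_single (W \ X)] at h4
          · rwa [Pi.single_eq_same, one_mul] at h4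
          · intro G _ hG
            rw [Pi.single_eq_of_ne hG, zero_mul]
          · exact fun h => absurd (Finset.mem_univ _) h
        · refine Finset.sum_eq_zero fun v hv => ?_
          have : y ((W \ X).erase v) = 0 := by
            by_contra hne
            apply hc
            rw [← Finset.card_erase_add_one hv, hyc _ hne]
          rw [this, mul_zero]
      rw [h2] at h1
      have h5 := congrArg (starSign K W (W \ X) * ·) h1
      simpa [← mul_assoc, starSign_mul_self] using h5.symm
    · rw [koszulD_apply]
      refine Finset.sum_eq_zero fun v _ => ?_
      have : z (insert v X) = 0 := by
        by_contra hne
        exact hX ((Finset.subset_insert _ _).trans (hzW _ hne))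
      rw [this, smul_zero]
  have hz := hp z hzp hz0
  refine hf (LinearMap.ext fun g => ?_)
  rw [hfy]
  refine Finset.sum_eq_zero fun F _ => ?_
  have : y F = 0 := by
    by_contra hne
    have := hzy F (hy F hne).1
    rw [hz] at this
    simp only [Pi.zero_apply, mul_zero] at this
    exact hne this.symm
  rw [this, zero_mul]

end Duality

/-! ### Top homology and exactness in square-free multidegrees -/

section Main

variable {K : Type u} [Field K] {n d : ℕ} {Δ : AbstractSimplicialComplex (Fin n)}

/-- No face has `d + 1` vertices, so there are no boundaries in dimension `d - 1` and homology
equals cycles. -/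
theorem subsingleton_reducedHomology_iff (hd : ∀ F, IsFace Δ F → F.card ≤ d) :
    Subsingleton (ReducedHomology K Δ ((d : ℤ) - 1)) ↔
      ∀ z : Finset (Fin n) → K, (∀ G, z G ≠ 0 → IsFace Δ G ∧ G.card = d) →
        koszulD (fun _ => (1 : K)) z = 0 → z = 0 := by
  have hb : simplicialBoundaries K Δ ((d : ℤ) - 1) = ⊥ := by
    rw [simplicialBoundaries, eq_bot_iff]
    rintro _ ⟨c, hc, rfl⟩
    have : c = 0 := by
      ext F
      by_contra hF
      obtain ⟨h1, h2⟩ := hc F hF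
      have := hd F h1
      omega
    rw [this, map_zero]
    exact zero_mem _
  rw [Submodule.Quotient.subsingleton_iff, Submodule.comap_subtype_eq_top, hb]
  constructor
  · intro h z hz hz0
    refine h ⟨fun F hF => ⟨(hz F hF).1, ?_⟩, ?_⟩
    · rw [(hz F hF).2]
    · exact (boundary_eq_koszulD K n z).trans hz0
  · rintro h z ⟨hz, hz0⟩
    refine h z (fun G hG => ⟨(hz G hG).1, ?_⟩) ?_
    · have := (hz G hG).2
      omega
    · rw [← boundary_eq_koszulD]
      exact hz0

theorem multiVanishes_of_homology (hd : ∀ F, IsFace Δ F → F.card ≤ d)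
    (hH : ∀ z : Finset (Fin n) → K, (∀ G, z G ≠ 0 → IsFace Δ G ∧ G.card = d) →
        koszulD (fun _ => (1 : K)) z = 0 → z = 0) {i : ℕ} {a : Fin n →₀ ℕ}
    (ha : i + d < a.degree) : MultiVanishes K Δ i a := by
  by_cases h2 : ∃ v, 2 ≤ a v
  · obtain ⟨v, hv⟩ := h2
    exact multiVanishes_of_two_le hv
  push Not at h2
  obtain ⟨W, rfl⟩ : ∃ W, a = indicatorExp W := ⟨_, eq_indicatorExp_support h2⟩
  rw [degree_indicatorExp] at ha
  rw [multiVanishes_indicatorExp_iff]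
  intro u hu0 hu
  obtain ⟨v, hv⟩ := Finset.card_pos.mp (by omega : 0 < W.card)
  have hb0 := koszulD_cone_of_cycle v hu0
  have hb : ∀ F, cone v u F ≠ 0 → F.card = i + 1 ∧ F ⊆ W := by
    intro F hF
    obtain ⟨hvF, hne⟩ := cone_ne_zero hF
    obtain ⟨h3, h4, -⟩ := hu _ hne
    refine ⟨by rw [← Finset.card_erase_add_one hvF, h3], ?_⟩
    rw [← Finset.insert_erase hvF]
    exact Finset.insert_subset hv h4
  -- The size `W.card - d` is that of the complement in `W` of a `d`-element face; it equals `i + 1`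
  -- in the critical case, the only one where `g` is used.
  obtain ⟨e, g, he, hg, heg⟩ := exists_koszulD_add_eq (W := W) (i := W.card - d) hH
    (fun G hG hGp => by rw [Finset.card_sdiff_of_subset hG, hGp.2]) (cone v u)
  by_cases hr : W.card = i + 1 + d
  -- The corrected chain `g` has the same boundary as the cone and vanishes at complements of
  -- `d`-element faces.
  · have hgb : g = cone v u - koszulD (fun _ => (1 : K)) e := by rw [← heg, add_sub_cancel_left]
    refine ⟨g, by rw [hgb, map_sub, koszulD_koszulD, sub_zero, hb0], fun F hF => ?_⟩
    have hF' : F.card = i + 1 ∧ F ⊆ W := by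
      by_cases h3 : cone v u F = 0
      · have h4 : koszulD (fun _ => (1 : K)) e F ≠ 0 := by
          intro h4
          exact hF (by rw [hgb, Pi.sub_apply, h3, h4, sub_zero])
        obtain ⟨w, hw, hne⟩ := Finset.exists_ne_zero_of_sum_ne_zero h4
        obtain ⟨h5, h6⟩ := he (insert w F) (fun h0 => hne (by rw [h0, smul_zero]))
        rw [Finset.card_insert_of_notMem (by simpa using hw)] at h6
        exact ⟨by omega, (Finset.subset_insert _ _).trans h5⟩
      · exact hb F h3
    refine ⟨hF'.1, hF'.2, fun hface => hg F hF ⟨hF'.2, hface, ?_⟩⟩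
    rw [Finset.card_sdiff_of_subset hF'.2]
    omega
  -- Here `W.card > i + 1 + d`, so the complement of an `(i + 1)`-element set is too large to be a
  -- face.
  · refine ⟨cone v u, hb0, fun F hF => ⟨(hb F hF).1, (hb F hF).2, fun hface => ?_⟩⟩
    have h3 := hd _ hface
    rw [Finset.card_sdiff_of_subset (hb F hF).2, (hb F hF).1] at h3
    omega

theorem homology_of_multiVanishes (hd : ∀ F, IsFace Δ F → F.card ≤ d) (hne : ∃ F, ¬ IsFace Δ F)
    (h : ∀ i, i + d < n → MultiVanishes K Δ i (indicatorExp Finset.univ))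
    (z : Finset (Fin n) → K) (hz : ∀ G, z G ≠ 0 → IsFace Δ G ∧ G.card = d)
    (hz0 : koszulD (fun _ => (1 : K)) z = 0) : z = 0 := by
  classical
  ext G
  by_contra hG
  obtain ⟨hface, hcard⟩ := hz G hG
  -- A missing vertex gives `d < n`, so that `n - d - 1` is a true difference; `v` is also the apex
  -- of the cone used below.
  obtain ⟨v, hv⟩ : ∃ v, v ∉ G := by
    by_contra hall
    push Not at hall
    obtain ⟨F, hF⟩ := hne
    exact hF (hface.mono fun v _ => hall v)
  have hcardc : Gᶜ.card = n - d := by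
    rw [Finset.card_compl, Fintype.card_fin, hcard]
  have hpos : 0 < Gᶜ.card := Finset.card_pos.mpr ⟨v, by simpa using hv⟩
  -- The boundary of `b` lives on sets whose complements have `d + 1` vertices and so are nonfaces.
  -- Exactness replaces `b` by some `b'` with the same boundary, supported on complements of
  -- nonfaces.
  let b : Finset (Fin n) → K := Pi.single Gᶜ 1
  obtain ⟨b', hb', hbs⟩ := multiVanishes_indicatorExp_iff.mp (h (n - d - 1) (by omega))
    (koszulD (fun _ => (1 : K)) b) (koszulD_koszulD _ _) (by
    intro F hF
    obtain ⟨w, hw, hne⟩ := Finset.exists_ne_zero_of_sum_ne_zero hF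
    have hwF : w ∉ F := by simpa using hw
    have hins : insert w F = Gᶜ := by
      by_contra h0
      exact hne (by simp only [b]; rw [Pi.single_eq_of_ne h0, smul_zero])
    have hc := congrArg Finset.card hins
    rw [Finset.card_insert_of_notMem hwF, hcardc] at hc
    refine ⟨by omega, Finset.subset_univ _, fun hf => ?_⟩
    have := hd _ hf
    rw [Finset.card_sdiff_of_subset (Finset.subset_univ _), Finset.card_univ,
      Fintype.card_fin] at this
    omega)
  have hcyc : koszulD (fun _ => (1 : K)) (b - b') = 0 := by rw [map_sub, hb', sub_self]
  -- The cycle `b - b'` is the boundary of its cone, hence pairs to zero with the signed complement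
  -- of `z`. As `z` lives on faces, `b'` contributes nothing, and the pairing is `z G` up to sign.
  have hpair := sum_star_mul_koszulD_eq_zero (W := Finset.univ) (fun G _ => Finset.subset_univ G)
    hz0 (a := cone v (b - b')) (fun H _ => Finset.subset_univ H)
  rw [koszulD_cone_of_cycle v hcyc, Finset.sum_eq_single Gᶜ] at hpair
  · have hb'0 : b' Gᶜ = 0 := by
      by_contra h0
      refine (hbs _ h0).2.2 ?_
      rwa [← Finset.compl_eq_univ_sdiff, compl_compl]
    have hb1 : (b - b') Gᶜ = 1 := by
      rw [Pi.sub_apply, hb'0, sub_zero]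
      exact Pi.single_eq_same _ _
    rw [hb1, mul_one, ← Finset.compl_eq_univ_sdiff, compl_compl] at hpair
    have h1 := starSign_mul_self (K := K) Finset.univ Gᶜ
    exact hG ((mul_eq_zero.mp hpair).resolve_left (left_ne_zero_of_mul (h1 ▸ one_ne_zero)))
  · intro F _ hF
    have hbF : b F = 0 := Pi.single_eq_of_ne hF _
    rw [Pi.sub_apply, hbF, zero_sub]
    by_cases h0 : b' F = 0
    · rw [h0, neg_zero, mul_zero]
    · have : z (Finset.univ \ F) = 0 := by
        by_contra hzF
        exact (hbs F h0).2.2 (hz _ hzF).1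
      rw [this, mul_zero, zero_mul]
  · exact fun h => absurd (Finset.mem_univ _) h

end Main

end LinRes
end

theorem mainTheorem5 {K : Type*} [Field K] {n d : ℕ} (Δ : AbstractSimplicialComplex (Fin n))
    (hdim : LinRes.dimension Δ = (d : ℤ) - 1)
    (hindeg : LinRes.indeg (LinRes.idealPart (LinRes.stanleyReisnerIdeal K Δ)) = (d : ℕ∞)) :
    LinRes.HasLinearResolution (n := n) (LinRes.idealPart (LinRes.stanleyReisnerIdeal K Δ)) d ↔
      Subsingleton (LinRes.ReducedHomology K Δ ((d : ℤ) - 1)) := by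
  have hd : ∀ F, LinRes.IsFace Δ F → F.card ≤ d := fun F => LinRes.card_le_of_dimension hdim
  rw [LinRes.hasLinearResolution_iff _ hindeg, LinRes.subsingleton_reducedHomology_iff hd]
  constructor
  · intro h
    refine LinRes.homology_of_multiVanishes hd (LinRes.exists_not_isFace_of_indeg hindeg)
      fun i hi => LinRes.multiVanishes_of_koszulVanishes ?_
    refine h _ _ ?_
    rwa [LinRes.degree_indicatorExp, Finset.card_univ, Fintype.card_fin]
  · intro h i j hij
    exact LinRes.koszulVanishes_of_multiVanishes fun a ha =>
      LinRes.multiVanishes_of_homology hd h (by rwa [ha])
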